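/- Let $\Bbbk$ be a field. For an integer $n\ge 2$ let $S_n=\Bbbk[x_1,\dots,x_n]$, and for a finitely generated graded $S_n$-module $M$ let $\beta_i(M)=\dim_{\Bbbk}\operatorname{Tor}_i^{S_n}(\Bbbk,M)$, where $\Bbbk=S_n/(x_1,\dots,x_n)$. For $1\le j\le n$ let $f_j=x_jx_{j+1}\cdots x_{j+n-3}$, with indices taken modulo $n$, and put $$I_n=(f_1,f_2,\dots,f_n),\qquad J_n=(f_1,f_3,\dots,f_n)$$ (thus $I_2=J_2=S_2$). For $s,t\ge 0$ and an integer $i$ set $b(n,s,t,i)=\beta_i(J_n^sI_n^t)$ if $i\ge 0$, and $b(n,s,t,i)=0$ if $i<0$. Let $k=\lfloor n/2\rfloor$, let $\binom{a}{c}=0$ unless $0\le c\le a$, let empty sums be $0$, and define $$p^+(n,s,t,i)=\sum_{j=0}^{\lfloor i/2\rfloor}\binom{n}{i-2j}\left[\binom{n+s+t-1-i+j}{n-1}-\binom{n+s-1-i+j}{n-1}\right],$$ $$p^-(n,s,t,i)=\begin{cases}\displaystyle\sum_{j=0}^{\lfloor (i-1)/2\rfloor}\binom{n}{i-1-2j}\left[\binom{s+t+k-1-j}{n-1}-\binom{s+k-1-j}{n-1}\right]&\text{if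 } n \text{ is odd},\\[3mm]\displaystyle\sum_{j=0}^{\lfloor i/2\rfloor}\binom{n}{i-2j}\left[\binom{s+t+k-1-j}{n-1}-\binom{s+k-1-j}{n-1}\right]&\text{if } n \text{ is even},\end{cases}$$ $$p^c(n,s,t,i)=\binom{n-2}{i}\binom{n+s-i-2}{n-2},\qquad p=p^+-p^-+p^c .$$ Then for all integers $n,s,t,i$ with $n\ge 2$ and $s,t\ge 0$, the space $\operatorname{Tor}_i^{S_n}(\Bbbk,J_n^sI_n^t)$ is finite-dimensional over $\Bbbk$ when $i\ge 0$, and $$b(n,s,t,i)=p(n,s,t,i).$$ -/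

import Mathlib

open CategoryTheory

noncomputable section

namespace PathIdealPowers

universe u

/-- The monomial `x_i x_{i+1} ⋯ x_{i+n-3}` in `𝕜[x_0, …, x_{n-1}]` (a product of `n - 2` cyclically
consecutive variables, indices modulo `n`). With indices shifted to start at `0`, the `i`-th monomial
is the usual `f_{i+1}`. For `n = 2` the product is empty, so the monomial is `1`. -/
def pathMonomial (𝕜 : Type u) [Field 𝕜] (n : ℕ) (i : Fin n) : MvPolynomial (Fin n) 𝕜 :=
  ∏ j ∈ Finset.range (n - 2), MvPolynomial.X (⟨(i.val + j) % n, Nat.mod_lt _ i.pos⟩ : Fin n)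

/-- `I_n = (f_1, …, f_n)`, the `(n-2)`-path ideal of the `n`-cycle; for `n = 2` it is the whole ring. -/
def cycleIdeal (𝕜 : Type u) [Field 𝕜] (n : ℕ) : Ideal (MvPolynomial (Fin n) 𝕜) :=
  Ideal.span (Set.range (pathMonomial 𝕜 n))

/-- `J_n = (f_1, f_3, …, f_n)`: the generator `f_2` (index `1` here) is omitted; for `n = 2` it is the
whole ring. -/
def omittedIdeal (𝕜 : Type u) [Field 𝕜] (n : ℕ) : Ideal (MvPolynomial (Fin n) 𝕜) :=
  Ideal.span (pathMonomial 𝕜 n '' {i | i.val ≠ 1})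

/-- The residue field `𝕜 = S / (x_1, …, x_n)` as a module over `S = 𝕜[x_1, …, x_n]`. -/
def residueField (𝕜 : Type u) [Field 𝕜] (n : ℕ) : ModuleCat.{u} (MvPolynomial (Fin n) 𝕜) :=
  ModuleCat.of _ (MvPolynomial (Fin n) 𝕜 ⧸
    Ideal.span (Set.range (MvPolynomial.X : Fin n → MvPolynomial (Fin n) 𝕜)))

/-- The `𝕜`-vector space `Tor_i^S(𝕜, L)` for an ideal `L` of `S = 𝕜[x_1, …, x_n]`. -/
def torSpace (𝕜 : Type u) [Field 𝕜] (n : ℕ) (L : Ideal (MvPolynomial (Fin n) 𝕜)) (i : ℕ) :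
    ModuleCat.{u} 𝕜 :=
  (ModuleCat.restrictScalars (algebraMap 𝕜 (MvPolynomial (Fin n) 𝕜))).obj
    (((Tor (ModuleCat.{u} (MvPolynomial (Fin n) 𝕜)) i).obj (residueField 𝕜 n)).obj
      (ModuleCat.of _ L))

/-- The Betti number `β_i(L) = dim_𝕜 Tor_i^S(𝕜, L)`. -/
def betti (𝕜 : Type u) [Field 𝕜] (n : ℕ) (L : Ideal (MvPolynomial (Fin n) 𝕜)) (i : ℕ) : ℕ :=
  Module.finrank 𝕜 (torSpace 𝕜 n L i)

/-- `b(n, s, t, i) = β_i(J_n^s I_n^t)` for `i ≥ 0`, and `0` for negative `i`. -/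
def b (𝕜 : Type u) [Field 𝕜] (n s t : ℕ) (i : ℤ) : ℤ :=
  if 0 ≤ i then (betti 𝕜 n (omittedIdeal 𝕜 n ^ s * cycleIdeal 𝕜 n ^ t) i.toNat : ℤ) else 0

/-- The binomial coefficient of two integers, `0` unless `0 ≤ c ≤ a`. -/
def binom (a c : ℤ) : ℤ :=
  if 0 ≤ c ∧ c ≤ a then (a.toNat.choose c.toNat : ℤ) else 0

/-! Below `/ 2` is floor division of integers; a sum over `Icc 0 m` with `m < 0` is empty. -/

/-- `p⁺`. -/
def pPos (n s t i : ℤ) : ℤ :=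
  ∑ j ∈ Finset.Icc 0 (i / 2), binom n (i - 2 * j) *
    (binom (n + s + t - 1 - i + j) (n - 1) - binom (n + s - 1 - i + j) (n - 1))

/-- `p⁻`, where `n = 2k + 1` or `n = 2k`, that is, `k = ⌊n / 2⌋`. -/
def pNeg (n s t i : ℤ) : ℤ :=
  let k := n / 2
  if Odd n then
    ∑ j ∈ Finset.Icc 0 ((i - 1) / 2), binom n (i - 1 - 2 * j) *
      (binom (s + t + k - 1 - j) (n - 1) - binom (s + k - 1 - j) (n - 1))
  else
    ∑ j ∈ Finset.Icc 0 (i / 2), binom n (i - 2 * j) *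
      (binom (s + t + k - 1 - j) (n - 1) - binom (s + k - 1 - j) (n - 1))

/-- `pᶜ`. -/
def pConst (n s i : ℤ) : ℤ :=
  binom (n - 2) i * binom (n + s - i - 2) (n - 2)

/-- `p = p⁺ - p⁻ + pᶜ`. -/
def p (n s t i : ℤ) : ℤ :=
  pPos n s t i - pNeg n s t i + pConst n s i

end PathIdealPowers

end

/-!
Let `n = m + 2`. The generator `f_j` of `I_n` is the product of all variables but two cyclically
consecutive ones, so it corresponds to an edge of the cycle on `Fin n`, and a product of `s + t`
generators to an exponent vector `a`, that is, to a multigraph on the cycle with `s + t` edges. The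
exponent of a variable in the product is `s + t` minus the degree of the corresponding vertex
(`edgeDegree`). The edges are numbered such that the generator missing from `J_n` has number `0`.
Then `J_n ^ s * I_n ^ t` is generated by the monomials of the vectors `a` with total `s + t` and
`a 0 ≤ t`.

In the lexicographic order of the exponent vectors these monomials have linear quotients: the colon
ideal of the smaller monomials by the one of `a` is generated by the variables in `colonVars a`
(`mul_mem_span_iff`), unless the monomial of `a` already occurs among the smaller ones, which is the
case exactly if `a` contains the perfect matching `0, 2, …, m` of an even cycle (`IsRedundant`).
Edge exchanges show that these variables lie in the colon ideal (`exists_lt_of_mem_colonVars`), and a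
comparison of partial sums of degrees shows that they suffice (`exists_mem_colonVars`).

Adjoining the monomials one by one, the mapping cone with the Koszul resolution of the colon ideal
gives a linear free resolution of `J_n ^ s * I_n ^ t` (`exists_linear_quotient`,
`exists_linearResolution`). The entries of its differentials are linear forms and vanish in the
residue field, so `Tor` has the ranks of the free modules as its dimensions (`finrank_torSpace`).
Hence the `i`-th Betti number is the sum of `(#(colonVars a)).choose i` over the irredundant
vectors `a`.

Passing from `J_n ^ (s + 1) * I_n ^ t` to `J_n ^ s * I_n ^ (t + 1)` adds the vectors with
`a 0 = t + 1` (`bettiPolynomial_succ`). The generating function of their contributions satisfies a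
recursion in steps of two in `n`, and is found in closed form in `chainSeries_eq`. The same
difference of values of `p` is computed in `p_succ_sub`, and for `t = 0` both sides are `pᶜ`, so
induction on `t` concludes.
-/

/-! ### Linear free resolutions and mapping cones -/

namespace PathIdealPowers

open MvPolynomial Matrix

section LinearResolutions

variable {σ : Type*} {𝕜 : Type*} [Field 𝕜]

lemma homogeneousComponent_mul_of_isHomogeneous {e p : ℕ} {a : MvPolynomial σ 𝕜}
    (ha : a.IsHomogeneous e) (b : MvPolynomial σ 𝕜) :
    homogeneousComponent (e + p) (a * b) = a * homogeneousComponent p b := by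
  let := MvPolynomial.gradedAlgebra (σ := σ) (R := 𝕜)
  have h := DirectSum.coe_decompose_mul_add_of_left_mem (homogeneousSubmodule σ 𝕜) (i := e)
    (j := p) (a := a) (b := b) ha
  have e1 : ∀ (φ : MvPolynomial σ 𝕜) (i : ℕ),
      (DirectSum.decompose (homogeneousSubmodule σ 𝕜) φ i : MvPolynomial σ 𝕜) =
        homogeneousComponent i φ := fun φ i => decomposition.decompose'_apply φ i
  rwa [e1, e1] at h

/-- If the columns of the homogeneous matrix `M` lie in the column space of the homogeneous matrix
`A`, then `M` factors through `A` by a homogeneous matrix of the expected degree. -/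
lemma exists_homogeneous_factorization {α β γ : Type*} [Fintype β] {e p : ℕ}
    (A : Matrix α β (MvPolynomial σ 𝕜)) (hA : ∀ i j, (A i j).IsHomogeneous e)
    (M : Matrix α γ (MvPolynomial σ 𝕜)) (hM : ∀ i j, (M i j).IsHomogeneous (e + p))
    (h : ∀ j, ∃ u, M.col j = A *ᵥ u) :
    ∃ N : Matrix β γ (MvPolynomial σ 𝕜), (∀ i j, (N i j).IsHomogeneous p) ∧ A * N = M := by
  choose u hu using h
  refine ⟨Matrix.of fun b c => homogeneousComponent p (u c b),
    fun i j => homogeneousComponent_isHomogeneous _ _, ?_⟩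
  ext1 i j
  have h1 := congrFun (hu j) i
  simp only [Matrix.col_apply, Matrix.mulVec, dotProduct] at h1
  rw [← homogeneousComponent_eq_self (hM i j), h1, map_sum, Matrix.mul_apply]
  refine Finset.sum_congr rfl fun b _ => ?_
  rw [homogeneousComponent_mul_of_isHomogeneous (hA i b)]
  rfl

/-- A linear free resolution `⋯ → S^{ι 1} → S^{ι 0} → L → 0` of an ideal `L` generated in degree
`d` of the polynomial ring `S`, given by matrices: `g` is the row of generators and the `A i` are
the differentials. -/
structure LinearResolution (d : ℕ) (L : Ideal (MvPolynomial σ 𝕜)) where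
  ι : ℕ → Type
  [fintype : ∀ i, Fintype (ι i)]
  g : Matrix Unit (ι 0) (MvPolynomial σ 𝕜)
  A : ∀ i, Matrix (ι i) (ι (i + 1)) (MvPolynomial σ 𝕜)
  isHomogeneous_g : ∀ a b, (g a b).IsHomogeneous d
  isHomogeneous_A : ∀ i a b, (A i a b).IsHomogeneous 1
  mem_iff : ∀ x, x ∈ L ↔ ∃ u, (fun _ => x) = g *ᵥ u
  exact_g : ∀ w, g *ᵥ w = 0 ↔ ∃ u, w = A 0 *ᵥ u
  exact_A : ∀ i w, A i *ᵥ w = 0 ↔ ∃ u, w = A (i + 1) *ᵥ u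

attribute [instance] LinearResolution.fintype

/-- A linear free resolution of `S ⧸ C`, for an ideal `C` generated by linear forms: the first
module has rank one and `E 0` is the row of generators of `C`. -/
structure QuotientResolution (C : Ideal (MvPolynomial σ 𝕜)) where
  κ : ℕ → Type
  [fintype : ∀ i, Fintype (κ i)]
  [unique : Unique (κ 0)]
  E : ∀ i, Matrix (κ i) (κ (i + 1)) (MvPolynomial σ 𝕜)
  isHomogeneous_E : ∀ i a b, (E i a b).IsHomogeneous 1
  mem_iff : ∀ x, x ∈ C ↔ ∃ u, (fun _ => x) = E 0 *ᵥ u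
  exact_E : ∀ i w, E i *ᵥ w = 0 ↔ ∃ u, w = E (i + 1) *ᵥ u

attribute [instance] QuotientResolution.fintype QuotientResolution.unique

lemma QuotientResolution.E_mul_E {C : Ideal (MvPolynomial σ 𝕜)}
    (K : QuotientResolution C) (i : ℕ) : K.E i * K.E (i + 1) = 0 := by
  classical
  refine Matrix.ext_of_mulVec_single fun j => ?_
  rw [← Matrix.mulVec_mulVec, Matrix.zero_mulVec]
  exact (K.exact_E i _).2 ⟨_, rfl⟩

namespace LinearResolution

variable {d : ℕ} {L C : Ideal (MvPolynomial σ 𝕜)}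

lemma A_mul_A (F : LinearResolution d L) (i : ℕ) : F.A i * F.A (i + 1) = 0 := by
  classical
  refine Matrix.ext_of_mulVec_single fun j => ?_
  rw [← Matrix.mulVec_mulVec, Matrix.zero_mulVec]
  exact (F.exact_A i _).2 ⟨_, rfl⟩

/-- The index types of the resolution of `S ⧸ L` obtained from one of `L`. -/
def shiftIndex (ι : ℕ → Type) : ℕ → Type
  | 0 => Unit
  | i + 1 => ι i

/-- The resolution of `S ⧸ L` obtained from one of `L`, by splicing. -/
def quotient (F : LinearResolution 1 C) : QuotientResolution C where
  κ := shiftIndex F.ι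
  fintype
    | 0 => inferInstanceAs (Fintype Unit)
    | i + 1 => inferInstanceAs (Fintype (F.ι i))
  unique := inferInstanceAs (Unique Unit)
  E
    | 0 => F.g
    | i + 1 => F.A i
  isHomogeneous_E
    | 0 => F.isHomogeneous_g
    | i + 1 => F.isHomogeneous_A i
  mem_iff := F.mem_iff
  exact_E
    | 0 => F.exact_g
    | i + 1 => F.exact_A i

/-- The row matrix with all entries `f`. -/
def constRow {R : Type*} (β : Type) (f : R) : Matrix Unit β R := Matrix.of fun _ _ => f

lemma constRow_mulVec {β : Type} {R : Type*} [Unique β] [Fintype β] [CommSemiring R] (f : R)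
    (w : β → R) : constRow β f *ᵥ w = fun _ => f * w default := by
  ext1
  exact Fintype.sum_unique _

/-- Multiplication by a form `f` with `f • C ⊆ L` lifts to a map of linear resolutions whose
entries are again linear forms. -/
lemma exists_lift (F : LinearResolution d L) (K : QuotientResolution C) {f : MvPolynomial σ 𝕜}
    (hf : f.IsHomogeneous d) (hC : ∀ w ∈ C, f * w ∈ L) :
    ∃ φ : ∀ i, Matrix (F.ι i) (K.κ (i + 1)) (MvPolynomial σ 𝕜),
      (∀ i a b, (φ i a b).IsHomogeneous 1) ∧ F.g * φ 0 = constRow (K.κ 0) f * K.E 0 ∧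
        ∀ i, F.A i * φ (i + 1) = φ i * K.E (i + 1) := by
  classical
  obtain ⟨φ₀, h₀, h₀'⟩ := exists_homogeneous_factorization (p := 1) F.g F.isHomogeneous_g
    (constRow (K.κ 0) f * K.E 0) (fun a b => by
      rw [Matrix.mul_apply]
      exact IsHomogeneous.sum _ _ _ fun c _ => hf.mul (K.isHomogeneous_E 0 c b)) (fun j => by
      have : K.E 0 default j ∈ C := (K.mem_iff _).2 ⟨Pi.single j 1, by
        ext1 c
        rw [Unique.eq_default c]
        simp⟩
      obtain ⟨u, hu⟩ := (F.mem_iff _).1 (hC _ this)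
      refine ⟨u, ?_⟩
      rw [← hu]
      ext1
      rw [Matrix.col_apply, Matrix.mul_apply, Fintype.sum_unique]
      rfl)
  -- the invariant carried along the construction: the next lifting problem is solvable
  let P (i : ℕ) := {φ : Matrix (F.ι i) (K.κ (i + 1)) (MvPolynomial σ 𝕜) //
    (∀ a b, (φ a b).IsHomogeneous 1) ∧ ∀ j, ∃ u, (φ * K.E (i + 1)).col j = F.A i *ᵥ u}
  have step (i : ℕ) (φ : P i) : ∃ ψ : P (i + 1), F.A i * ψ.1 = φ.1 * K.E (i + 1) := by
    obtain ⟨ψ, h1, h2⟩ := exists_homogeneous_factorization (p := 1) (F.A i) (F.isHomogeneous_A i)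
      (φ.1 * K.E (i + 1)) (fun a b => by
        rw [Matrix.mul_apply]
        exact IsHomogeneous.sum _ _ _ fun c _ =>
          (φ.2.1 a c).mul (K.isHomogeneous_E (i + 1) c b)) φ.2.2
    refine ⟨⟨ψ, h1, fun j => (F.exact_A i _).1 ?_⟩, h2⟩
    rw [← Matrix.mulVec_single_one, Matrix.mulVec_mulVec, ← Matrix.mul_assoc, h2, Matrix.mul_assoc,
      K.E_mul_E, Matrix.mul_zero, Matrix.zero_mulVec]
  choose next hnext using step
  let φ : ∀ i, P i := fun i => Nat.rec (motive := P) ⟨φ₀, h₀, fun j => (F.exact_g _).1 (by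
    rw [← Matrix.mulVec_single_one, Matrix.mulVec_mulVec, ← Matrix.mul_assoc, h₀',
      Matrix.mul_assoc, K.E_mul_E, Matrix.mul_zero, Matrix.zero_mulVec])⟩ next i
  exact ⟨fun i => (φ i).1, fun i => (φ i).2.1, h₀', fun i => hnext i (φ i)⟩

/-- The mapping cone: if `L = L' + (f)` and `(L' : f) = C`, linear resolutions of `L'` and `C`
combine to one of `L`. -/
theorem exists_cone {L' : Ideal (MvPolynomial σ 𝕜)} (F : LinearResolution d L')
    (K : QuotientResolution C) {f : MvPolynomial σ 𝕜} (hf : f.IsHomogeneous d)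
    (hC : ∀ w, f * w ∈ L' ↔ w ∈ C) :
    ∃ R : LinearResolution d (L' ⊔ Ideal.span {f}), ∀ i,
      Fintype.card (R.ι i) = Fintype.card (F.ι i) + Fintype.card (K.κ i) := by
  obtain ⟨φ, h1, h2, h3⟩ := F.exists_lift K hf fun w hw => (hC w).2 hw
  let g : Matrix Unit (F.ι 0 ⊕ K.κ 0) (MvPolynomial σ 𝕜) :=
    Matrix.fromCols F.g (constRow (K.κ 0) f)
  have hg (w) : g *ᵥ w = F.g *ᵥ (w ∘ Sum.inl) + fun _ => f * w (Sum.inr default) := by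
    rw [Matrix.fromCols_mulVec]
    rw [constRow_mulVec]
    rfl
  let A (i : ℕ) : Matrix (F.ι i ⊕ K.κ i) (F.ι (i + 1) ⊕ K.κ (i + 1))
      (MvPolynomial σ 𝕜) := Matrix.fromBlocks (F.A i) (φ i) 0 (-K.E i)
  have hA (i : ℕ) (w) : A i *ᵥ w = Sum.elim (F.A i *ᵥ (w ∘ Sum.inl) + φ i *ᵥ (w ∘ Sum.inr))
      (-(K.E i *ᵥ (w ∘ Sum.inr))) := by
    rw [Matrix.fromBlocks_mulVec, Matrix.zero_mulVec, zero_add, Matrix.neg_mulVec]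
  refine ⟨⟨fun i => F.ι i ⊕ K.κ i, g, A, ?_, ?_, ?_, ?_, ?_⟩, fun i => Fintype.card_sum⟩
  · rintro a (b | b)
    · exact F.isHomogeneous_g a b
    · exact hf
  · rintro i (a | a) (b | b)
    · exact F.isHomogeneous_A i a b
    · exact h1 i a b
    · exact isHomogeneous_zero _ _ _
    · exact (K.isHomogeneous_E i a b).neg
  · intro x
    rw [Submodule.mem_sup]
    constructor
    · rintro ⟨y, hy, z, hz, rfl⟩
      obtain ⟨u, hu⟩ := (F.mem_iff y).1 hy
      obtain ⟨v, rfl⟩ := Ideal.mem_span_singleton'.1 hz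
      refine ⟨Sum.elim u fun _ => v, ?_⟩
      rw [hg, Sum.elim_comp_inl, ← hu]
      ext1
      simp [mul_comm]
    · rintro ⟨u, hu⟩
      rw [hg] at hu
      refine ⟨(F.g *ᵥ (u ∘ Sum.inl)) (), (F.mem_iff _).2 ⟨_, rfl⟩, f * u (Sum.inr default),
        Ideal.mul_mem_right _ _ (Ideal.mem_span_singleton_self f), (congrFun hu ()).symm⟩
  · intro w
    rw [hg]
    constructor
    · intro h
      have hw : w (Sum.inr default) ∈ C := by
        rw [← hC, ← neg_neg (f * _)]
        refine neg_mem ((F.mem_iff _).2 ⟨w ∘ Sum.inl, ?_⟩)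
        rw [eq_neg_of_add_eq_zero_left h]
        rfl
      obtain ⟨v, hv⟩ := (K.mem_iff _).1 hw
      have h4 : F.g *ᵥ (w ∘ Sum.inl + φ 0 *ᵥ v) = 0 := by
        rw [Matrix.mulVec_add, Matrix.mulVec_mulVec, h2, ← Matrix.mulVec_mulVec, ← hv,
          constRow_mulVec]
        exact h
      obtain ⟨u, hu⟩ := (F.exact_g _).1 h4
      refine ⟨Sum.elim u (-v), ?_⟩
      rw [hA]
      ext1 (a | a)
      · simp only [Sum.elim_inl, Sum.elim_comp_inl, Sum.elim_comp_inr, Matrix.mulVec_neg, ← hu]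
        simp
      · simp only [Sum.elim_inr, Sum.elim_comp_inr, Matrix.mulVec_neg, neg_neg]
        rw [Unique.eq_default a]
        exact congrFun hv default
    · rintro ⟨u, rfl⟩
      rw [hA, Sum.elim_comp_inl, Matrix.mulVec_add, (F.exact_g _).2 ⟨_, rfl⟩, zero_add,
        Matrix.mulVec_mulVec, h2, ← Matrix.mulVec_mulVec, constRow_mulVec]
      ext1
      simp
  · intro i w
    rw [hA]
    constructor
    · intro h
      have e1 : F.A i *ᵥ (w ∘ Sum.inl) + φ i *ᵥ (w ∘ Sum.inr) = 0 := by
        ext1 a; exact congrFun h (Sum.inl a)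
      have e2 : K.E i *ᵥ (w ∘ Sum.inr) = 0 := by
        ext1 a; exact neg_eq_zero.1 (congrFun h (Sum.inr a))
      obtain ⟨v, hv⟩ := (K.exact_E i _).1 e2
      have h4 : F.A i *ᵥ (w ∘ Sum.inl + φ (i + 1) *ᵥ v) = 0 := by
        rw [Matrix.mulVec_add, Matrix.mulVec_mulVec, h3, ← Matrix.mulVec_mulVec, ← hv]
        exact e1
      obtain ⟨u, hu⟩ := (F.exact_A i _).1 h4
      refine ⟨Sum.elim u (-v), ?_⟩
      rw [hA]
      ext1 (a | a)
      · simp only [Sum.elim_inl, Sum.elim_comp_inl, Sum.elim_comp_inr, Matrix.mulVec_neg, ← hu]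
        simp
      · simp only [Sum.elim_inr, Sum.elim_comp_inr, Matrix.mulVec_neg, neg_neg]
        exact congrFun hv a
    · rintro ⟨u, rfl⟩
      rw [hA, Sum.elim_comp_inl, Sum.elim_comp_inr, Matrix.mulVec_add,
        (F.exact_A i _).2 ⟨_, rfl⟩, zero_add, Matrix.mulVec_mulVec, h3, Matrix.mulVec_neg]
      have e2 : K.E i *ᵥ (K.E (i + 1) *ᵥ (u ∘ Sum.inr)) = 0 :=
        (K.exact_E i _).2 ⟨_, rfl⟩
      ext1 (a | a)
      · simp only [Sum.elim_inl]
        rw [← Matrix.mulVec_mulVec]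
        exact congrFun (add_neg_cancel _) a
      · rw [Matrix.mulVec_neg, e2]
        simp

/-- The zero ideal has the zero resolution. -/
lemma exists_bot (d : ℕ) : ∃ R : LinearResolution d (⊥ : Ideal (MvPolynomial σ 𝕜)),
    ∀ i, Fintype.card (R.ι i) = 0 :=
  ⟨{ ι := fun _ => Empty
     g := 0
     A := fun _ => 0
     isHomogeneous_g := fun _ b => b.elim
     isHomogeneous_A := fun _ a => a.elim
     mem_iff := fun x => by simp [funext_iff]
     exact_g := fun w => by simpa using Subsingleton.elim _ _
     exact_A := fun i w => by simpa using Subsingleton.elim _ _ }, fun _ => rfl⟩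

lemma X_mul_mem_span_X_iff {s : Set σ} {v : σ} (hv : v ∉ s) (w : MvPolynomial σ 𝕜) :
    X v * w ∈ Ideal.span (X '' s : Set (MvPolynomial σ 𝕜)) ↔
      w ∈ Ideal.span (X '' s : Set (MvPolynomial σ 𝕜)) := by
  classical
  refine ⟨fun h => ?_, fun h => Ideal.mul_mem_left _ _ h⟩
  rw [mem_ideal_span_X_image] at h ⊢
  intro m hm
  obtain ⟨i, hi, h1⟩ := h (Finsupp.single v 1 + m) (by
    rw [mem_support_iff, coeff_X_mul]; exact mem_support_iff.1 hm)
  refine ⟨i, hi, ?_⟩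
  have : v ≠ i := by rintro rfl; exact hv hi
  simpa [Finsupp.single_apply, this] using h1

lemma card_quotient_κ (F : LinearResolution 1 C) {N : ℕ}
    (h : ∀ i, Fintype.card (F.ι i) = N.choose (i + 1)) (i : ℕ) :
    Fintype.card (F.quotient.κ i) = N.choose i := by
  cases i with
  | zero => rw [Nat.choose_zero_right]; exact Fintype.card_unique
  | succ i => exact h i

/-- The Koszul resolution of an ideal generated by variables, as an iterated mapping cone: each
new variable is a nonzerodivisor modulo the previous ones. -/
lemma exists_koszul (V : Finset σ) :
    ∃ R : LinearResolution 1 (Ideal.span (X '' (V : Set σ) : Set (MvPolynomial σ 𝕜))),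
      ∀ i, Fintype.card (R.ι i) = V.card.choose (i + 1) := by
  classical
  induction V using Finset.induction_on with
  | empty =>
    obtain ⟨R, hR⟩ := exists_bot (σ := σ) (𝕜 := 𝕜) 1
    rw [Finset.coe_empty, Set.image_empty, Ideal.span_empty]
    exact ⟨R, fun i => by simp [hR]⟩
  | insert v V hv ih =>
    obtain ⟨K, hK⟩ := ih
    obtain ⟨R, hR⟩ := K.exists_cone K.quotient (isHomogeneous_X 𝕜 v)
      (X_mul_mem_span_X_iff (by exact_mod_cast hv))
    have e : Ideal.span (X '' (insert v V : Finset σ) : Set (MvPolynomial σ 𝕜)) =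
        Ideal.span (X '' (V : Set σ)) ⊔ Ideal.span {X v} := by
      rw [Finset.coe_insert, Set.image_insert_eq, Ideal.span_insert, sup_comm]
    rw [e]
    refine ⟨R, fun i => ?_⟩
    rw [hR, Finset.card_insert_of_notMem hv, Nat.choose_succ_succ, hK, K.card_quotient_κ hK,
      add_comm]

/-- Adjoining one generator with a colon ideal generated by the variables in `V` adds
`V.card.choose i` to the `i`-th Betti number. -/
theorem exists_linear_quotient {L' : Ideal (MvPolynomial σ 𝕜)} (F : LinearResolution d L')
    (V : Finset σ) {f : MvPolynomial σ 𝕜} (hf : f.IsHomogeneous d)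
    (hV : ∀ w, f * w ∈ L' ↔ w ∈ Ideal.span (X '' (V : Set σ) : Set (MvPolynomial σ 𝕜))) :
    ∃ R : LinearResolution d (L' ⊔ Ideal.span {f}), ∀ i,
      Fintype.card (R.ι i) = Fintype.card (F.ι i) + V.card.choose i := by
  obtain ⟨K, hK⟩ := exists_koszul (𝕜 := 𝕜) V
  obtain ⟨R, hR⟩ := F.exists_cone K.quotient hf hV
  exact ⟨R, fun i => by rw [hR, K.card_quotient_κ hK]⟩

end LinearResolution

end LinearResolutions

end PathIdealPowers

/-! ### Tor from a linear resolution -/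

namespace PathIdealPowers

open MvPolynomial Matrix TensorProduct

section Tor

universe v

variable {𝕜 : Type v} [Field 𝕜] {n d : ℕ} {L : Ideal (MvPolynomial (Fin n) 𝕜)}

namespace LinearResolution

/-- The chain complex of free modules underlying a linear resolution. -/
noncomputable def complex (F : LinearResolution d L) :
    ChainComplex (ModuleCat.{v} (MvPolynomial (Fin n) 𝕜)) ℕ :=
  ChainComplex.of (fun i => ModuleCat.of _ (F.ι i → MvPolynomial (Fin n) 𝕜))
    (fun i => ModuleCat.ofHom (F.A i).mulVecLin) fun i => by
      ext1
      rw [ModuleCat.hom_comp, ModuleCat.hom_ofHom, ModuleCat.hom_ofHom, ← Matrix.mulVecLin_mul,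
        F.A_mul_A, Matrix.mulVecLin_zero]
      rfl

lemma complex_d (F : LinearResolution d L) (i : ℕ) :
    F.complex.d (i + 1) i = ModuleCat.ofHom (F.A i).mulVecLin := by
  dsimp only [complex]
  exact ChainComplex.of_d (fun i => ModuleCat.of (MvPolynomial (Fin n) 𝕜)
    (F.ι i → MvPolynomial (Fin n) 𝕜)) _ i

/-- The map `S^{ι 0} → L` given by the row of generators. -/
noncomputable def augmentation (F : LinearResolution d L) :
    (F.ι 0 → MvPolynomial (Fin n) 𝕜) →ₗ[MvPolynomial (Fin n) 𝕜] L :=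
  LinearMap.codRestrict L (LinearMap.proj () ∘ₗ F.g.mulVecLin) fun w => (F.mem_iff _).2 ⟨w, rfl⟩

lemma augmentation_eq_zero_iff (F : LinearResolution d L) (w : F.ι 0 → MvPolynomial (Fin n) 𝕜) :
    F.augmentation w = 0 ↔ F.g *ᵥ w = 0 := by
  rw [Subtype.ext_iff, funext_iff]
  exact ⟨fun h _ => h, fun h => h ()⟩

/-- A linear resolution as a projective resolution. -/
noncomputable def projectiveResolution (F : LinearResolution d L) :
    ProjectiveResolution (ModuleCat.of (MvPolynomial (Fin n) 𝕜) L) where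
  complex := F.complex
  projective i := inferInstanceAs
    (Projective (ModuleCat.of (MvPolynomial (Fin n) 𝕜) (F.ι i → MvPolynomial (Fin n) 𝕜)))
  π := (F.complex.toSingle₀Equiv _).symm ⟨ModuleCat.ofHom F.augmentation, by
    rw [F.complex_d]
    ext1
    refine LinearMap.ext fun w => ?_
    exact (F.augmentation_eq_zero_iff _).2 ((F.exact_g _).2 ⟨w, rfl⟩)⟩
  quasiIso := ⟨fun m => by
    cases m with
    | zero =>
      rw [ChainComplex.quasiIsoAt₀_iff, ShortComplex.quasiIso_iff_of_zeros' _ (by simp; rfl) rfl rfl]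
      constructor
      · rw [ShortComplex.moduleCat_exact_iff]
        intro w hw
        replace hw : F.augmentation w = 0 := by
          convert! hw
        obtain ⟨u, hu⟩ := (F.exact_g w).1 ((F.augmentation_eq_zero_iff _).1 hw)
        refine ⟨u, ?_⟩
        change F.complex.d 1 0 u = w
        rw [F.complex_d 0]
        exact hu.symm
      · rw [ModuleCat.epi_iff_surjective]
        intro x
        obtain ⟨u, hu⟩ := (F.mem_iff _).1 x.2
        refine ⟨u, ?_⟩
        have : F.augmentation u = x := Subtype.ext (congrFun hu ()).symm
        convert! this
    | succ m =>
      rw [quasiIsoAt_iff_exactAt' (hL := ChainComplex.exactAt_succ_single_obj ..),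
          HomologicalComplex.exactAt_iff' _ (m + 2) (m + 1) m (by simp) (by simp),
          ShortComplex.moduleCat_exact_iff]
      intro w hw
      replace hw : F.complex.d (m + 1) m w = 0 := hw
      rw [F.complex_d] at hw
      obtain ⟨u, hu⟩ := (F.exact_A m w).1 hw
      refine ⟨u, ?_⟩
      change F.complex.d (m + 2) (m + 1) u = w
      rw [F.complex_d (m + 1)]
      exact hu.symm⟩

end LinearResolution

lemma mem_span_range_X_iff (f : MvPolynomial (Fin n) 𝕜) :
    f ∈ Ideal.span (Set.range (X : Fin n → MvPolynomial (Fin n) 𝕜)) ↔ constantCoeff f = 0 := by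
  rw [← Set.image_univ, mem_ideal_span_X_image, constantCoeff_eq, ← notMem_support_iff]
  constructor
  · intro h h0
    obtain ⟨i, -, hi⟩ := h 0 h0
    exact hi rfl
  · intro h m hm
    by_contra! H
    exact h (by rwa [show m = 0 from Finsupp.ext fun i => H i trivial] at hm)

/-- The residue field is one-dimensional, via the constant coefficient. -/
noncomputable def residueFieldEquiv :
    (MvPolynomial (Fin n) 𝕜 ⧸ Ideal.span (Set.range (X : Fin n → MvPolynomial (Fin n) 𝕜)))
      ≃ₗ[𝕜] 𝕜 :=
  ((Ideal.quotientEquivAlgOfEq 𝕜 (by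
    ext f
    rw [mem_span_range_X_iff, RingHom.mem_ker]
    simp)).trans
    (Ideal.quotientKerAlgEquivOfSurjective
      (f := (aeval (fun _ => 0) : MvPolynomial (Fin n) 𝕜 →ₐ[𝕜] 𝕜))
      fun c => ⟨C c, by simp⟩)).toLinearEquiv

lemma finrank_restrictScalars {κ : Type} [Fintype κ]
    (M : ModuleCat.{v} (MvPolynomial (Fin n) 𝕜))
    (e : M ≃ₗ[MvPolynomial (Fin n) 𝕜] (κ → MvPolynomial (Fin n) 𝕜 ⧸
      Ideal.span (Set.range (X : Fin n → MvPolynomial (Fin n) 𝕜)))) :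
    Module.Finite 𝕜
      ((ModuleCat.restrictScalars (algebraMap 𝕜 (MvPolynomial (Fin n) 𝕜))).obj M) ∧
    Module.finrank 𝕜
      ((ModuleCat.restrictScalars (algebraMap 𝕜 (MvPolynomial (Fin n) 𝕜))).obj M) =
        Fintype.card κ := by
  let e' : (ModuleCat.restrictScalars (algebraMap 𝕜 (MvPolynomial (Fin n) 𝕜))).obj M ≃ₗ[𝕜]
      (κ → MvPolynomial (Fin n) 𝕜 ⧸
        Ideal.span (Set.range (X : Fin n → MvPolynomial (Fin n) 𝕜))) :=
    { e.toAddEquiv with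
      map_smul' := fun c x => by
        refine (e.map_smul (algebraMap 𝕜 _ c) x).trans ?_
        rw [algebraMap_smul]
        rfl }
  let e'' := e'.trans (LinearEquiv.piCongrRight fun _ => residueFieldEquiv)
  exact ⟨Module.Finite.equiv e''.symm, by rw [e''.finrank_eq, Module.finrank_fintype_fun_eq_card]⟩

lemma tmul_eq_zero_of_constantCoeff {κ : Type} [Fintype κ]
    (r : MvPolynomial (Fin n) 𝕜 ⧸
      Ideal.span (Set.range (X : Fin n → MvPolynomial (Fin n) 𝕜)))
    (w : κ → MvPolynomial (Fin n) 𝕜) (hw : ∀ a, constantCoeff (w a) = 0) :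
    r ⊗ₜ[MvPolynomial (Fin n) 𝕜] w = 0 := by
  classical
  obtain ⟨r, rfl⟩ := Ideal.Quotient.mk_surjective r
  rw [pi_eq_sum_univ' w, TensorProduct.tmul_sum]
  refine Finset.sum_eq_zero fun a _ => ?_
  have h0 : w a • Ideal.Quotient.mk
      (Ideal.span (Set.range (X : Fin n → MvPolynomial (Fin n) 𝕜))) r = 0 :=
    Ideal.Quotient.eq_zero_iff_mem.2
      (Ideal.mul_mem_right _ _ ((mem_span_range_X_iff _).2 (hw a)))
  rw [← TensorProduct.smul_tmul, h0, TensorProduct.zero_tmul]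

lemma LinearResolution.tensor_d_eq_zero (F : LinearResolution d L) (i j : ℕ) :
    ((((MonoidalCategory.tensoringLeft (ModuleCat.{v} (MvPolynomial (Fin n) 𝕜))).obj
      (residueField 𝕜 n)).mapHomologicalComplex _).obj F.complex).d i j = 0 := by
  by_cases h : j + 1 = i
  · subst h
    change MonoidalCategory.whiskerLeft (residueField 𝕜 n) (F.complex.d (j + 1) j) = 0
    rw [F.complex_d]
    refine ModuleCat.MonoidalCategory.tensor_ext fun r w => ?_
    refine tmul_eq_zero_of_constantCoeff r (F.A j *ᵥ w) fun a => ?_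
    rw [← mem_span_range_X_iff]
    refine Ideal.sum_mem _ fun b _ => Ideal.mul_mem_right _ _ ?_
    rw [mem_span_range_X_iff]
    exact (F.isHomogeneous_A j a b).coeff_eq_zero (by simp)
  · exact HomologicalComplex.shape _ _ _ h

/-- A linear resolution computes `Tor`: its differentials have entries in the maximal ideal, hence
vanish after tensoring with the residue field. -/
theorem LinearResolution.finrank_torSpace (F : LinearResolution d L) (i : ℕ) :
    Module.Finite 𝕜 (torSpace 𝕜 n L i) ∧ betti 𝕜 n L i = Fintype.card (F.ι i) := by
  classical
  have e := F.projectiveResolution.isoLeftDerivedObj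
    ((MonoidalCategory.tensoringLeft (ModuleCat.{v} (MvPolynomial (Fin n) 𝕜))).obj
      (residueField 𝕜 n)) i
  have e2 := (ShortComplex.HomologyData.ofZeros (((((MonoidalCategory.tensoringLeft
      (ModuleCat.{v} (MvPolynomial (Fin n) 𝕜))).obj
      (residueField 𝕜 n)).mapHomologicalComplex _).obj F.complex).sc i)
      (F.tensor_d_eq_zero _ _) (F.tensor_d_eq_zero _ _)).left.homologyIso
  have e3 := TensorProduct.piScalarRight (MvPolynomial (Fin n) 𝕜) (MvPolynomial (Fin n) 𝕜)
    (MvPolynomial (Fin n) 𝕜 ⧸ Ideal.span (Set.range (X : Fin n → MvPolynomial (Fin n) 𝕜)))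
    (F.ι i)
  exact finrank_restrictScalars _ ((e ≪≫ e2).toLinearEquiv.trans e3)

end Tor

end PathIdealPowers

/-! ### Exchange of edges in multigraphs on a cycle -/

namespace PathIdealPowers

open MvPolynomial

section Exponents

variable {m : ℕ}

open scoped Fin.CommRing

/-- The number of edges at the vertex `u` of the multigraph with `a j` copies of the edge
`{j - 1, j}` of the cycle on `Fin (m + 2)`. -/
def edgeDegree (a : Fin (m + 2) → ℕ) (u : Fin (m + 2)) : ℕ := a u + a (u + 1)

/-- `u` is even and `x` is positive at all odd places below `u`. For the shift `x j = a (j + 1)` of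
an exponent vector `a`, this says that the edges `2, 4, …, u`, which together with the edge `0`
cover the vertices `-1, 0, …, u`, all occur in `a`. -/
def IsChain (x : ℕ → ℕ) (u : ℕ) : Prop := Even u ∧ ∀ j < u, Odd j → 0 < x j

lemma isChain_zero (x : ℕ → ℕ) : IsChain x 0 := ⟨Even.zero, by simp⟩

lemma isChain_add_two {x : ℕ → ℕ} {u : ℕ} :
    IsChain x (u + 2) ↔ IsChain x u ∧ 0 < x (u + 1) := by
  constructor
  · rintro ⟨h1, h2⟩
    have h3 : Even u := by simpa [Nat.even_add] using h1
    exact ⟨⟨h3, fun j hj => h2 j (by omega)⟩, h2 (u + 1) (by omega) h3.add_one⟩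
  · rintro ⟨⟨h1, h2⟩, h3⟩
    refine ⟨h1.add even_two, fun j hj ho => ?_⟩
    rcases (show j < u ∨ j = u ∨ j = u + 1 by omega) with h | rfl | rfl
    · exact h2 j h ho
    · exact absurd h1 (Nat.not_even_iff_odd.2 ho)
    · exact h3

/-- If `B` is smaller than `A` in the `0`-th entry and the vertex degrees of `B` are at least those
of `A` at all vertices in the colon ideal of `A`, then the totals of `A` and `B` differ.

The sums over the last edge and the edges below `p` are compared for increasing `p`. As long as the
chain goes on, those of `B` are strictly larger at even `p`. If an edge of the chain is missing, they
stay larger for good. Otherwise the chain reaches `m - 1` for odd `m`, and then the totals are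
compared at `m + 1`, or it reaches `m` for even `m`, which is excluded. -/
lemma not_sum_eq_of_dominates {A B : ℕ → ℕ} (h0 : B 0 < A 0)
    (hlast : A (m + 1) + A 0 ≤ B (m + 1) + B 0)
    (hpos : ∀ u < m, 0 < A (u + 1) → A u + A (u + 1) ≤ B u + B (u + 1))
    (hchain : ∀ u < m, IsChain (fun j => A (j + 1)) u → A u + A (u + 1) ≤ B u + B (u + 1))
    (hm : ¬ IsChain (fun j => A (j + 1)) m) :
    ∑ j ∈ Finset.range (m + 2), A j ≠ ∑ j ∈ Finset.range (m + 2), B j := by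
  intro hsum
  rw [Finset.sum_range_succ, Finset.sum_range_succ _ (m + 1)] at hsum
  let P (p : ℕ) : ℕ := ∑ j ∈ Finset.range p, A j
  let Q (p : ℕ) : ℕ := ∑ j ∈ Finset.range p, B j
  have hP (p) : P (p + 1) = P p + A p := Finset.sum_range_succ _ _
  have hQ (p) : Q (p + 1) = Q p + B p := Finset.sum_range_succ _ _
  change P (m + 1) + _ = Q (m + 1) + _ at hsum
  have key : ∀ i, 2 * i ≤ m → IsChain (fun j => A (j + 1)) (2 * i) ∧
      A (m + 1) + P (2 * i) < B (m + 1) + Q (2 * i) ∧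
      A (m + 1) + P (2 * i + 1) ≤ B (m + 1) + Q (2 * i + 1) := by
    intro i
    induction i with
    | zero =>
      intro _
      refine ⟨isChain_zero _, ?_, ?_⟩
      · simp only [P, Q, mul_zero, Finset.range_zero, Finset.sum_empty]
        omega
      · simpa [P, Q] using hlast
    | succ i ih =>
      intro hi
      obtain ⟨h1, h2, h3⟩ := ih (by omega)
      have h4 := hchain (2 * i) (by omega) h1
      have e1 := hP (2 * i); have e2 := hQ (2 * i)
      have e3 : P (2 * i + 2) = _ := hP (2 * i + 1)
      have e4 : Q (2 * i + 2) = _ := hQ (2 * i + 1)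
      have e5 := hP (2 * i + 2); have e6 := hQ (2 * i + 2)
      have h5 : 0 < A (2 * i + 2) := by
        by_contra hA
        -- once the edge `2 * i + 2` is missing from `A`, the strict inequality propagates: from `p`
        -- to `p + 1` if the edge `p` is missing as well, and from `p - 1` to `p + 1` otherwise
        have hR : ∀ k, 2 * i + 2 + k ≤ m →
            A (m + 1) + P (2 * i + 2 + k) < B (m + 1) + Q (2 * i + 2 + k) ∧
            A (m + 1) + P (2 * i + 2 + k + 1) < B (m + 1) + Q (2 * i + 2 + k + 1) := by
          intro k
          induction k with
          | zero => intro _; rw [add_zero]; exact ⟨by omega, by omega⟩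
          | succ k ihk =>
            intro hk
            obtain ⟨r1, r2⟩ := ihk (by omega)
            refine ⟨r2, ?_⟩
            have f1 := hP (2 * i + 2 + k); have f2 := hQ (2 * i + 2 + k)
            have f3 := hP (2 * i + 2 + k + 1); have f4 := hQ (2 * i + 2 + k + 1)
            have f5 := hpos (2 * i + 2 + k) (by omega)
            rw [← add_assoc, f3, f4]
            omega
        have := (hR (m - (2 * i + 2)) (by omega)).2
        rw [show 2 * i + 2 + (m - (2 * i + 2)) = m by omega] at this
        omega
      have h6 : A (2 * i + 1) + A (2 * i + 2) ≤ B (2 * i + 1) + B (2 * i + 2) :=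
        hpos (2 * i + 1) (by omega) h5
      refine ⟨isChain_add_two.2 ⟨h1, h5⟩, ?_, ?_⟩
      · rw [show 2 * (i + 1) = 2 * i + 2 by ring]; omega
      · rw [show 2 * (i + 1) = 2 * i + 2 by ring]; omega
  rcases Nat.even_or_odd' m with ⟨i, hi | hi⟩
  · exact hm (hi ▸ (key i hi.ge).1)
  · obtain ⟨h1, h2, -⟩ := key i (by omega)
    have h4 := hchain (2 * i) (by omega) h1
    have e1 := hP (2 * i); have e2 := hQ (2 * i)
    have e3 := hP (2 * i + 1); have e4 := hQ (2 * i + 1)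
    subst hi
    omega

/-- An exponent vector is redundant if its monomial is also given by a lexicographically smaller
vector. This happens only for `m` even, and is encoded as the occurrence of the perfect matching
`0, 2, …, m` of the cycle: it can be replaced by the other perfect matching `1, 3, …, m + 1`. The
encoding is justified by `IsRedundant.exists_lt` and `exists_mem_colonVars`. -/
def IsRedundant (a : Fin (m + 2) → ℕ) : Prop :=
  0 < a 0 ∧ IsChain (fun j => a ((j + 1 : ℕ) : Fin (m + 2))) m

open Classical in
/-- The variables that generate the colon ideal of the monomial of `a` with respect to the
monomials of the lexicographically smaller vectors, see `mul_mem_span_iff`. -/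
noncomputable def colonVars (a : Fin (m + 2) → ℕ) : Finset (Fin (m + 2)) :=
  {u | (u.val < m ∧ (0 < a (u + 1) ∨
      0 < a 0 ∧ IsChain (fun j => a ((j + 1 : ℕ) : Fin (m + 2))) u)) ∨
    (u.val = m + 1 ∧ 0 < a 0)}

lemma edgeDegree_single (p w : Fin (m + 2)) :
    edgeDegree (Pi.single p 1) w = (Pi.single p 1 + Pi.single (p - 1) 1 : Fin (m + 2) → ℕ) w := by
  simp only [edgeDegree, Pi.add_apply, Pi.single_apply, eq_sub_iff_add_eq]

lemma exists_eq_add_single {a : Fin (m + 2) → ℕ} {p : Fin (m + 2)} (h : 0 < a p) :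
    ∃ c : Fin (m + 2) → ℕ, a = c + Pi.single p 1 := by
  refine ⟨a - Pi.single p 1, (tsub_add_cancel_of_le fun j => ?_).symm⟩
  by_cases hj : j = p
  · subst hj; simpa using! h
  · simp [hj]

lemma edgeDegree_add (a b : Fin (m + 2) → ℕ) (w : Fin (m + 2)) :
    edgeDegree (a + b) w = edgeDegree a w + edgeDegree b w := by
  simp only [edgeDegree, Pi.add_apply]; ring

/-- Replacing the edge `p` by the edge `p + 1` costs one variable at the vertex `p - 1`. -/
lemma exists_shift_up {a : Fin (m + 2) → ℕ} {p : Fin (m + 2)} (h : 0 < a p) (hp : p.val ≤ m) :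
    ∃ b : Fin (m + 2) → ℕ, ∑ j, b j = ∑ j, a j ∧ b 0 ≤ a 0 ∧ toLex b < toLex a ∧
      ∀ w, edgeDegree a w ≤ edgeDegree b w + (Pi.single (p - 1) 1 : Fin (m + 2) → ℕ) w := by
  obtain ⟨c, rfl⟩ := exists_eq_add_single h
  have hp1 : p.val < (p + 1).val := by
    rw [Fin.val_add_one_of_lt (Fin.lt_def.2 (by simp; omega))]; omega
  have h0 : p + 1 ≠ 0 := by
    intro h; rw [h] at hp1; simp at hp1
  refine ⟨c + Pi.single (p + 1) 1, by simp [Finset.sum_add_distrib], ?_, ⟨p, ?_, ?_⟩, fun w => ?_⟩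
  · simp [Pi.single_eq_of_ne h0.symm]
  · intro j (hj : j < p)
    have : j ≠ p + 1 := by rintro rfl; exact absurd (hp1.trans hj) (lt_irrefl _)
    simp [this, hj.ne]
  · have : p ≠ p + 1 := by intro h; rw [← h] at hp1; exact lt_irrefl _ hp1
    simp [this]
  · simp only [edgeDegree_add, edgeDegree_single, add_sub_cancel_right, Pi.add_apply]
    omega

/-- Replacing the edges `0, 2, …, 2 * i` by the edges `-1, 1, …, 2 * i - 1` removes the vertex
`2 * i` and adds the vertex `-2`, that is, `m`. -/
lemma exists_shift_down (i : ℕ) (hi : 2 * i ≤ m) (a : Fin (m + 2) → ℕ) (h0 : 0 < a 0)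
    (h : IsChain (fun j => a ((j + 1 : ℕ) : Fin (m + 2))) (2 * i)) :
    ∃ b : Fin (m + 2) → ℕ, ∑ j, b j = ∑ j, a j ∧ b 0 < a 0 ∧
      ∀ w, edgeDegree a w + (Pi.single ((m : ℕ) : Fin (m + 2)) 1 : Fin (m + 2) → ℕ) w =
        edgeDegree b w + (Pi.single ((2 * i : ℕ) : Fin (m + 2)) 1 : Fin (m + 2) → ℕ) w := by
  induction i generalizing a with
  | zero =>
    obtain ⟨c, rfl⟩ := exists_eq_add_single h0
    have hm : ((m : ℕ) : Fin (m + 2)) = -1 - 1 := by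
      have : ((m + 2 : ℕ) : Fin (m + 2)) = 0 := Fin.natCast_self _
      push_cast at this
      linear_combination this
    refine ⟨c + Pi.single (-1) 1, by simp [Finset.sum_add_distrib], ?_, fun w => ?_⟩
    · have : (0 : Fin (m + 2)) ≠ -1 := by
        intro h; simpa using congrArg Fin.val (neg_eq_zero.1 h.symm)
      simp [this]
    · simp only [edgeDegree_add, edgeDegree_single, hm, Pi.add_apply, mul_zero, Nat.cast_zero,
        zero_sub]
      omega
  | succ i ih =>
    obtain ⟨h1, h2⟩ := isChain_add_two.1 h
    replace h2 : 0 < a ((2 * i + 2 : ℕ) : Fin (m + 2)) := h2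
    replace h1 : IsChain (fun j => a ((j + 1 : ℕ) : Fin (m + 2))) (2 * i) := h1
    obtain ⟨c, rfl⟩ := exists_eq_add_single h2
    have hv (k : ℕ) (hk : k < m + 2) : ((k : ℕ) : Fin (m + 2)).val = k := Fin.val_cast_of_lt hk
    have hne (k l : ℕ) (hk : k < m + 2) (hl : l < m + 2) (hkl : k ≠ l) :
        ((k : ℕ) : Fin (m + 2)) ≠ (l : Fin (m + 2)) := by
      intro e; apply hkl; rw [← hv k hk, e, hv l hl]
    have e0 : (0 : Fin (m + 2)) ≠ ((2 * i + 2 : ℕ) : Fin (m + 2)) := by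
      simpa using hne 0 (2 * i + 2) (by omega) (by omega) (by omega)
    have e0' : (0 : Fin (m + 2)) ≠ ((2 * i + 1 : ℕ) : Fin (m + 2)) := by
      simpa using hne 0 (2 * i + 1) (by omega) (by omega) (by omega)
    have h0' : 0 < c 0 := by
      rwa [Pi.add_apply, Pi.single_eq_of_ne e0, add_zero] at h0
    obtain ⟨b, hb1, hb2, hb3⟩ := ih (by omega) (c + Pi.single ((2 * i + 1 : ℕ) : Fin (m + 2)) 1)
      (by simp only [Pi.add_apply]; omega) ⟨h1.1, fun j hj ho => by
        have := h1.2 j hj ho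
        have e := hne (j + 1) (2 * i + 2) (by omega) (by omega) (by omega)
        simp only [Pi.add_apply, Pi.single_eq_of_ne e] at this ⊢
        omega⟩
    refine ⟨b, ?_, ?_, fun w => ?_⟩
    · rw [hb1]; simp [Finset.sum_add_distrib]
    · rw [Pi.add_apply, Pi.single_eq_of_ne e0'] at hb2
      rwa [Pi.add_apply, Pi.single_eq_of_ne e0]
    · have := hb3 w
      have e1 : ((2 * i + 1 : ℕ) : Fin (m + 2)) - 1 = ((2 * i : ℕ) : Fin (m + 2)) := by
        push_cast; ring
      have e2 : ((2 * i + 2 : ℕ) : Fin (m + 2)) - 1 = ((2 * i + 1 : ℕ) : Fin (m + 2)) := by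
        push_cast; ring
      rw [show 2 * (i + 1) = 2 * i + 2 by ring]
      simp only [edgeDegree_add, edgeDegree_single, Pi.add_apply, e1, e2] at this ⊢
      omega

lemma toLex_lt_of_zero_lt {a b : Fin (m + 2) → ℕ} (h : b 0 < a 0) : toLex b < toLex a :=
  ⟨0, fun j hj => absurd hj (Fin.not_lt_zero j), h⟩

/-- The vertex degrees of a redundant vector are dominated by those of a smaller one. -/
lemma IsRedundant.exists_lt {a : Fin (m + 2) → ℕ} (ha : IsRedundant a) :
    ∃ b : Fin (m + 2) → ℕ, ∑ j, b j = ∑ j, a j ∧ b 0 ≤ a 0 ∧ toLex b < toLex a ∧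
      ∀ w, edgeDegree a w ≤ edgeDegree b w := by
  obtain ⟨i, hi⟩ := even_iff_exists_two_mul.1 ha.2.1
  obtain ⟨b, h1, h2, h3⟩ := exists_shift_down i hi.ge a ha.1 (hi ▸ ha.2)
  refine ⟨b, h1, h2.le, toLex_lt_of_zero_lt h2, fun w => ?_⟩
  have := h3 w
  rw [← hi] at this
  omega

/-- Each variable in `colonVars a` carries the monomial of `a` into the ideal of the smaller
monomials. -/
lemma exists_lt_of_mem_colonVars {a : Fin (m + 2) → ℕ} {v : Fin (m + 2)} (hv : v ∈ colonVars a) :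
    ∃ b : Fin (m + 2) → ℕ, ∑ j, b j = ∑ j, a j ∧ b 0 ≤ a 0 ∧ toLex b < toLex a ∧
      ∀ w, edgeDegree a w ≤ edgeDegree b w + (Pi.single v 1 : Fin (m + 2) → ℕ) w := by
  simp only [colonVars, Finset.mem_filter, Finset.mem_univ, true_and] at hv
  rcases hv with ⟨hm, h | ⟨h0, h⟩⟩ | ⟨hm, h⟩
  · have := exists_shift_up h (by
      rw [Fin.val_add_one_of_lt (Fin.lt_def.2 (by simp; omega))]; omega)
    rwa [add_sub_cancel_right] at this
  · obtain ⟨i, hi⟩ := even_iff_exists_two_mul.1 h.1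
    obtain ⟨b, h1, h2, h3⟩ := exists_shift_down i (by omega) a h0 (hi ▸ h)
    refine ⟨b, h1, h2.le, toLex_lt_of_zero_lt h2, fun w => ?_⟩
    have := h3 w
    rw [← hi, Fin.cast_val_eq_self] at this
    omega
  · have := exists_shift_up h (by simp)
    have e : v = 0 - 1 := by
      rw [eq_sub_iff_add_eq, show v = Fin.last (m + 1) from Fin.ext hm, Fin.last_add_one]
    rwa [← e] at this

/-- The variables in `colonVars a` suffice: if `b` is smaller than `a`, then one of them has a larger
exponent in the monomial of `b` than in that of `a`. -/
lemma exists_mem_colonVars {a b : Fin (m + 2) → ℕ} (ha : ¬ IsRedundant a)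
    (hsum : ∑ j, b j = ∑ j, a j) (hlt : toLex b < toLex a) :
    ∃ v ∈ colonVars a, edgeDegree b v < edgeDegree a v := by
  by_contra! H
  obtain ⟨i, hi, hlt⟩ := hlt
  change b i < a i at hlt
  replace hi : ∀ j < i, b j = a j := hi
  have hmem (v : Fin (m + 2)) := by
    have := H v
    simp only [colonVars, Finset.mem_filter, Finset.mem_univ, true_and] at this
    exact this
  have hcast (u : ℕ) (hu : u < m + 2) : ((u : ℕ) : Fin (m + 2)) = ⟨u, hu⟩ :=
    Fin.ext (Fin.val_cast_of_lt hu)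
  have hpos : ∀ u < m, 0 < a ((u + 1 : ℕ) : Fin (m + 2)) →
      a (u : Fin (m + 2)) + a ((u + 1 : ℕ) : Fin (m + 2)) ≤
        b (u : Fin (m + 2)) + b ((u + 1 : ℕ) : Fin (m + 2)) := by
    intro u hu h
    push_cast at h ⊢
    exact hmem (u : Fin (m + 2))
      (Or.inl ⟨by rw [Fin.val_cast_of_lt (by omega)]; exact hu, Or.inl h⟩)
  by_cases hi0 : i = 0
  · subst hi0
    refine not_sum_eq_of_dominates (m := m) (A := fun j => a (j : Fin (m + 2)))
      (B := fun j => b (j : Fin (m + 2))) (by simpa using hlt) ?_ hpos ?_ ?_ ?_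
    · have := hmem (Fin.last (m + 1)) (Or.inr ⟨rfl, by omega⟩)
      rw [edgeDegree, edgeDegree, Fin.last_add_one] at this
      simpa only [hcast (m + 1) (by omega), Nat.cast_zero] using! this
    · intro u hu h
      have := hmem (u : Fin (m + 2)) (Or.inl ⟨by rw [Fin.val_cast_of_lt (by omega)]; exact hu,
        Or.inr ⟨by omega, by rw [Fin.val_cast_of_lt (by omega)]; exact h⟩⟩)
      push_cast
      exact this
    · exact fun h => ha ⟨by omega, h⟩
    · rw [Finset.sum_range, Finset.sum_range]
      simpa using hsum.symm
  · obtain ⟨u, hu⟩ : ∃ u, i.val = u + 1 :=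
      Nat.exists_eq_succ_of_ne_zero fun h => hi0 (Fin.ext h)
    have hiu : i = ((u + 1 : ℕ) : Fin (m + 2)) := by
      rw [hcast _ (by omega)]; exact Fin.ext hu
    by_cases hum : u < m
    · have h1 := hpos u hum (by rw [← hiu]; omega)
      rw [← hiu, hi u (Fin.lt_def.2 (by rw [Fin.val_cast_of_lt (by omega)]; omega))] at h1
      omega
    · -- the last entry alone cannot differ, as the totals agree
      refine (Finset.sum_lt_sum (fun j _ => ?_) ⟨i, Finset.mem_univ i, hlt⟩).ne hsum
      rcases eq_or_ne j i with rfl | hj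
      · exact hlt.le
      · exact (hi j (Fin.lt_def.2 (by have := j.2; have := Fin.val_ne_of_ne hj; omega))).le

end Exponents

end PathIdealPowers

/-! ### Linear quotients of the products of powers -/

namespace PathIdealPowers

open MvPolynomial

section Monomials

open scoped Fin.CommRing

variable {m : ℕ} (𝕜 : Type*) [Field 𝕜]

/-- In the indexing by edges, the path monomial of the edge `{j - 1, j}` is the product of all
variables off that edge. -/
lemma pathMonomial_add_one (j : Fin (m + 2)) :
    pathMonomial 𝕜 (m + 2) (j + 1) = ∏ u with j ≠ u ∧ j ≠ u + 1, X u := by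
  unfold pathMonomial
  have hmod (a k : ℕ) (ha : a < m + 2) (hk : k < m) :
      (a + k) % (m + 2) = if a + k < m + 2 then a + k else a + k - (m + 2) := by
    split_ifs with h
    · exact Nat.mod_eq_of_lt h
    · rw [Nat.mod_eq_sub_mod (by omega), Nat.mod_eq_of_lt (by omega)]
  have hval (u : Fin (m + 2)) : (u + 1).val = if u.val = m + 1 then 0 else u.val + 1 := by
    rw [Fin.val_add_one]; simp [Fin.ext_iff]
  have hj := hval j
  have hj2 := j.2
  generalize j + 1 = i at hj
  have hi2 := i.2
  refine Finset.prod_nbij (fun k => ⟨(i.val + k) % (m + 2), Nat.mod_lt _ (by omega)⟩)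
    ?_ ?_ ?_ (fun _ _ => rfl)
  · intro k hk
    have hk : k < m := by simpa using hk
    simp only [Finset.mem_filter, Finset.mem_univ, true_and, ne_eq, Fin.ext_iff, hval,
      hmod _ _ hi2 hk]
    split_ifs at * <;> omega
  · intro k hk l hl h
    have hk : k < m := by simpa using hk
    have hl : l < m := by simpa using hl
    simp only [Fin.mk.injEq, hmod _ _ hi2 hk, hmod _ _ hi2 hl] at h
    split_ifs at h <;> omega
  · intro u hu
    have hu2 := u.2
    simp only [Finset.coe_filter, Finset.mem_univ, true_and, Set.mem_ofPred_eq, ne_eq,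
      Fin.ext_iff, hval] at hu
    obtain ⟨k, hk, hik⟩ : ∃ k < m, i.val + k = u.val ∨ i.val + k = u.val + (m + 2) := by
      by_cases h : i.val ≤ u.val
      · refine ⟨u.val - i.val, ?_, by omega⟩
        split_ifs at * <;> omega
      · refine ⟨u.val + (m + 2) - i.val, ?_, by omega⟩
        split_ifs at * <;> omega
    refine ⟨k, by simpa using hk, Fin.ext ?_⟩
    simp only [hmod _ _ hi2 hk]
    split_ifs <;> omega

/-- The monomial in the generators of `I_n` with exponent vector `a`, where the exponent `a j`
belongs to the generator that misses the edge `{j - 1, j}`. -/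
noncomputable def genMonomial (a : Fin (m + 2) → ℕ) : MvPolynomial (Fin (m + 2)) 𝕜 :=
  ∏ j, pathMonomial 𝕜 (m + 2) (j + 1) ^ a j

/-- The exponent vector of `genMonomial` in the variables: the generator that misses the edge `j`
contains all variables except the two on that edge. -/
noncomputable def genExponent (a : Fin (m + 2) → ℕ) : Fin (m + 2) →₀ ℕ :=
  Finsupp.equivFunOnFinite.symm fun u => ∑ j with j ≠ u ∧ j ≠ u + 1, a j

lemma genExponent_add_edgeDegree (a : Fin (m + 2) → ℕ) (u : Fin (m + 2)) :
    genExponent a u + edgeDegree a u = ∑ j, a j := by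
  rw [← Finset.sum_filter_add_sum_filter_not _ (fun j => j ≠ u ∧ j ≠ u + 1)]
  congr 1
  have : (Finset.univ.filter fun j : Fin (m + 2) => ¬(j ≠ u ∧ j ≠ u + 1)) = {u, u + 1} := by
    ext j; simp [imp_iff_not_or]
  rw [this, Finset.sum_pair (by simp), edgeDegree]

lemma genMonomial_eq (a : Fin (m + 2) → ℕ) : genMonomial 𝕜 a = monomial (genExponent a) 1 := by
  rw [monomial_eq, C_1, one_mul, Finsupp.prod_fintype _ _ fun _ => pow_zero _]
  simp only [genMonomial, pathMonomial_add_one, genExponent, ← Finset.prod_pow,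
    Finsupp.equivFunOnFinite_symm_apply_apply, ← Finset.prod_pow_eq_pow_sum]
  exact Finset.prod_comm' (by simp)

lemma genMonomial_zero : genMonomial 𝕜 (0 : Fin (m + 2) → ℕ) = 1 := by simp [genMonomial]

lemma genMonomial_add (a b : Fin (m + 2) → ℕ) :
    genMonomial 𝕜 (a + b) = genMonomial 𝕜 a * genMonomial 𝕜 b := by
  simp [genMonomial, pow_add, Finset.prod_mul_distrib]

lemma genMonomial_single (j : Fin (m + 2)) :
    genMonomial 𝕜 (Pi.single j 1) = pathMonomial 𝕜 (m + 2) (j + 1) := by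
  rw [genMonomial, Finset.prod_eq_single j] <;> simp +contextual

lemma isHomogeneous_genMonomial (a : Fin (m + 2) → ℕ) :
    (genMonomial 𝕜 a).IsHomogeneous (m * ∑ j, a j) := by
  rw [Finset.mul_sum]
  refine IsHomogeneous.prod _ _ _ fun j _ => IsHomogeneous.pow ?_ _
  simpa [pathMonomial] using IsHomogeneous.prod (Finset.range m) (fun k => X (R := 𝕜)
    (⟨((j + 1).val + k) % (m + 2), Nat.mod_lt _ (by omega)⟩ : Fin (m + 2))) (fun _ => 1)
    fun k _ => isHomogeneous_X _ _

/-- The exponent vectors of the generators of `J_n ^ s * I_n ^ t`, where `n = m + 2`. The entry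
`a 0` belongs to the generator of `I_n` that is missing from `J_n`. -/
def genVectors (m s t : ℕ) : Finset (Fin (m + 2) → ℕ) :=
  {a ∈ Finset.Nat.antidiagonalTuple (m + 2) (s + t) | a 0 ≤ t}

lemma mem_genVectors {s t : ℕ} {a : Fin (m + 2) → ℕ} :
    a ∈ genVectors m s t ↔ ∑ j, a j = s + t ∧ a 0 ≤ t := by
  simp [genVectors, Finset.Nat.mem_antidiagonalTuple]

lemma omittedIdeal_eq : omittedIdeal 𝕜 (m + 2) =
    Ideal.span ((fun j => genMonomial 𝕜 (Pi.single j 1)) '' {j : Fin (m + 2) | j ≠ 0}) := by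
  unfold omittedIdeal
  congr 1
  simp only [genMonomial_single]
  ext f
  constructor
  · rintro ⟨i, hi, rfl⟩
    refine ⟨i - 1, fun h => hi ?_, by simp⟩
    rw [sub_eq_zero.1 h]; rfl
  · rintro ⟨j, hj, rfl⟩
    refine ⟨j + 1, fun h => hj ?_, rfl⟩
    have : j + 1 = 1 := Fin.ext h
    simpa using this

lemma cycleIdeal_eq : cycleIdeal 𝕜 (m + 2) =
    Ideal.span (Set.range fun j : Fin (m + 2) => genMonomial 𝕜 (Pi.single j 1)) := by
  unfold cycleIdeal
  congr 1
  simp only [genMonomial_single]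
  exact ((Equiv.addRight (1 : Fin (m + 2))).surjective.range_comp _).symm

lemma omittedIdeal_mul_span (s t : ℕ) :
    omittedIdeal 𝕜 (m + 2) * Ideal.span (genMonomial 𝕜 '' (genVectors m s t : Set _)) =
      Ideal.span (genMonomial 𝕜 '' (genVectors m (s + 1) t : Set _)) := by
  rw [omittedIdeal_eq, Ideal.span_mul_span']
  congr 1
  ext f
  simp only [Set.mem_mul, Set.mem_image, Finset.mem_coe, mem_genVectors]
  constructor
  · rintro ⟨_, ⟨j, hj, rfl⟩, _, ⟨a, ⟨h1, h2⟩, rfl⟩, rfl⟩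
    refine ⟨Pi.single j 1 + a, ⟨?_, ?_⟩, genMonomial_add 𝕜 _ _⟩
    · simp [Finset.sum_add_distrib, h1]; ring
    · simpa [Pi.single_eq_of_ne (Ne.symm hj)] using h2
  · rintro ⟨a, ⟨h1, h2⟩, rfl⟩
    obtain ⟨j, hj, hj0⟩ : ∃ j, 0 < a j ∧ j ≠ 0 := by
      by_contra! H
      rw [Finset.sum_eq_single 0 (fun j _ hj => by by_contra h; exact hj (H j (by omega)))
        (by simp)] at h1
      omega
    obtain ⟨c, rfl⟩ := exists_eq_add_single hj
    refine ⟨_, ⟨j, hj0, rfl⟩, _, ⟨c, ⟨?_, ?_⟩, rfl⟩, ?_⟩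
    · simp [Finset.sum_add_distrib] at h1; omega
    · simpa [Pi.single_eq_of_ne hj0.symm] using h2
    · exact (genMonomial_add 𝕜 _ _).symm.trans (congrArg _ (add_comm _ _))

lemma cycleIdeal_mul_span (s t : ℕ) :
    cycleIdeal 𝕜 (m + 2) * Ideal.span (genMonomial 𝕜 '' (genVectors m s t : Set _)) =
      Ideal.span (genMonomial 𝕜 '' (genVectors m s (t + 1) : Set _)) := by
  rw [cycleIdeal_eq, Ideal.span_mul_span']
  congr 1
  ext f
  simp only [Set.mem_mul, Set.mem_image, Set.mem_range, Finset.mem_coe, mem_genVectors]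
  constructor
  · rintro ⟨_, ⟨j, rfl⟩, _, ⟨a, ⟨h1, h2⟩, rfl⟩, rfl⟩
    refine ⟨Pi.single j 1 + a, ⟨?_, ?_⟩, genMonomial_add 𝕜 _ _⟩
    · simp [Finset.sum_add_distrib, h1]; ring
    · have : (Pi.single j 1 : Fin (m + 2) → ℕ) 0 ≤ 1 := by
        rw [Pi.single_apply]; split_ifs <;> omega
      simp only [Pi.add_apply]; omega
  · rintro ⟨a, ⟨h1, h2⟩, rfl⟩
    obtain ⟨j, hj, hj0⟩ : ∃ j, 0 < a j ∧ (a 0 = 0 ∨ j = 0) := by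
      by_cases h0 : a 0 = 0
      · obtain ⟨j, -, hj⟩ := Finset.exists_ne_zero_of_sum_ne_zero (by omega : ∑ j, a j ≠ 0)
        exact ⟨j, by omega, Or.inl h0⟩
      · exact ⟨0, by omega, Or.inr rfl⟩
    obtain ⟨c, rfl⟩ := exists_eq_add_single hj
    refine ⟨_, ⟨j, rfl⟩, _, ⟨c, ⟨?_, ?_⟩, rfl⟩, ?_⟩
    · simp [Finset.sum_add_distrib] at h1; omega
    · simp only [Pi.add_apply] at h2 hj0
      rcases hj0 with h | rfl
      · omega
      · rw [Pi.single_eq_same] at h2; omega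
    · exact (genMonomial_add 𝕜 _ _).symm.trans (congrArg _ (add_comm _ _))

theorem omittedIdeal_pow_mul_cycleIdeal_pow (s t : ℕ) :
    omittedIdeal 𝕜 (m + 2) ^ s * cycleIdeal 𝕜 (m + 2) ^ t =
      Ideal.span (genMonomial 𝕜 '' (genVectors m s t : Set _)) := by
  induction s with
  | zero =>
    rw [pow_zero, one_mul]
    induction t with
    | zero =>
      rw [pow_zero, Ideal.one_eq_top, eq_comm, Ideal.eq_top_iff_one]
      exact Ideal.subset_span ⟨0, by simp [mem_genVectors], genMonomial_zero 𝕜⟩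
    | succ t ih => rw [pow_succ', ih, cycleIdeal_mul_span]
  | succ s ih => rw [pow_succ', mul_assoc, ih, omittedIdeal_mul_span]

lemma genExponent_le_iff {a b : Fin (m + 2) → ℕ} (h : ∑ j, b j = ∑ j, a j)
    (e : Fin (m + 2) →₀ ℕ) :
    genExponent b ≤ e + genExponent a ↔ ∀ w, edgeDegree a w ≤ edgeDegree b w + e w := by
  refine forall_congr' fun w => ?_
  have h1 := genExponent_add_edgeDegree a w
  have h2 := genExponent_add_edgeDegree b w
  rw [Finsupp.add_apply]
  omega

lemma genMonomial_mem_span_iff (a : Fin (m + 2) → ℕ) (S : Set (Fin (m + 2) → ℕ))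
    (w : MvPolynomial (Fin (m + 2)) 𝕜) :
    genMonomial 𝕜 a * w ∈ Ideal.span (genMonomial 𝕜 '' S) ↔
      ∀ e ∈ w.support, ∃ b ∈ S, genExponent b ≤ e + genExponent a := by
  have : genMonomial 𝕜 '' S = (fun e => monomial e (1 : 𝕜)) '' (genExponent '' S) := by
    rw [Set.image_image]; exact Set.image_congr fun b _ => genMonomial_eq 𝕜 b
  rw [this, mem_ideal_span_monomial_image, genMonomial_eq, mul_comm]
  constructor
  · intro h e he
    obtain ⟨_, ⟨b, hb, rfl⟩, h1⟩ := h (e + genExponent a) (by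
      rw [mem_support_iff, coeff_mul_monomial, mul_one]; exact mem_support_iff.1 he)
    exact ⟨b, hb, h1⟩
  · intro h e he
    rw [mem_support_iff, coeff_mul_monomial'] at he
    split_ifs at he with hle
    · rw [mul_one] at he
      obtain ⟨b, hb, h1⟩ := h _ (mem_support_iff.2 he)
      rw [tsub_add_cancel_of_le hle] at h1
      exact ⟨_, ⟨b, hb, rfl⟩, h1⟩
    · exact absurd rfl he

/-- The generators of `J_n ^ s * I_n ^ t` in lexicographic order have linear quotients: the colon
ideal of the ideal of the smaller generators by an irredundant one is generated by variables. -/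
theorem mul_mem_span_iff {s t : ℕ} {a : Fin (m + 2) → ℕ} (ha : a ∈ genVectors m s t)
    (hred : ¬ IsRedundant a) (w : MvPolynomial (Fin (m + 2)) 𝕜) :
    genMonomial 𝕜 a * w ∈
        Ideal.span (genMonomial 𝕜 '' {b | b ∈ genVectors m s t ∧ toLex b < toLex a}) ↔
      w ∈ Ideal.span (X '' (colonVars a : Set (Fin (m + 2)))) := by
  rw [genMonomial_mem_span_iff, mem_ideal_span_X_image]
  rw [mem_genVectors] at ha
  refine forall₂_congr fun e _ => ?_
  constructor
  · rintro ⟨b, ⟨hb, hlt⟩, hle⟩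
    have hsum : ∑ j, b j = ∑ j, a j := by rw [(mem_genVectors.1 hb).1, ha.1]
    obtain ⟨v, hv, hlt'⟩ := exists_mem_colonVars hred hsum hlt
    refine ⟨v, hv, ?_⟩
    have := (genExponent_le_iff hsum e).1 hle v
    omega
  · rintro ⟨v, hv, he⟩
    obtain ⟨b, h1, h2, h3, h4⟩ := exists_lt_of_mem_colonVars hv
    refine ⟨b, ⟨mem_genVectors.2 ⟨by rw [h1, ha.1], h2.trans ha.2⟩, h3⟩,
      (genExponent_le_iff h1 e).2 fun w => (h4 w).trans (Nat.add_le_add_left ?_ _)⟩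
    rw [Pi.single_apply]
    split_ifs with h
    · subst h; omega
    · omega

lemma IsRedundant.genMonomial_mem {s t : ℕ} {a : Fin (m + 2) → ℕ} (ha : a ∈ genVectors m s t)
    (hred : IsRedundant a) : genMonomial 𝕜 a ∈
      Ideal.span (genMonomial 𝕜 '' {b | b ∈ genVectors m s t ∧ toLex b < toLex a}) := by
  rw [mem_genVectors] at ha
  rw [← mul_one (genMonomial 𝕜 a), genMonomial_mem_span_iff]
  intro e _
  obtain ⟨b, h1, h2, h3, h4⟩ := hred.exists_lt
  exact ⟨b, ⟨mem_genVectors.2 ⟨by rw [h1, ha.1], h2.trans ha.2⟩, h3⟩,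
    (genExponent_le_iff h1 e).2 fun w => (h4 w).trans (Nat.le_add_right _ _)⟩

open Classical in
/-- `J_n ^ s * I_n ^ t` has a linear resolution, with Betti numbers read off from the colon
ideals. -/
theorem exists_linearResolution (m s t : ℕ) :
    ∃ R : LinearResolution (m * (s + t)) (omittedIdeal 𝕜 (m + 2) ^ s * cycleIdeal 𝕜 (m + 2) ^ t),
      ∀ i, Fintype.card (R.ι i) =
        ∑ a ∈ genVectors m s t with ¬ IsRedundant a, (colonVars a).card.choose i := by
  rw [omittedIdeal_pow_mul_cycleIdeal_pow]
  -- the generators are adjoined in lexicographic order, along initial segments `S`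
  suffices H : ∀ S : Finset (Lex (Fin (m + 2) → ℕ)), (∀ a ∈ S, ofLex a ∈ genVectors m s t) →
      (∀ a ∈ S, ∀ b ∈ genVectors m s t, toLex b < a → toLex b ∈ S) →
      ∃ R : LinearResolution (m * (s + t)) (Ideal.span (genMonomial 𝕜 '' {b | toLex b ∈ S})),
        ∀ i, Fintype.card (R.ι i) =
          ∑ a ∈ S with ¬ IsRedundant (ofLex a), (colonVars (ofLex a)).card.choose i by
    have h := H ((genVectors m s t).map toLex.toEmbedding) (by simp)
      fun a _ b hb _ => by simpa using hb
    have e : {b | toLex b ∈ (genVectors m s t).map toLex.toEmbedding} =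
        (genVectors m s t : Set (Fin (m + 2) → ℕ)) := by ext; simp
    rw [e] at h
    obtain ⟨R, hR⟩ := h
    refine ⟨R, fun i => ?_⟩
    rw [hR, Finset.filter_map, Finset.sum_map]
    rfl
  intro S
  induction S using Finset.induction_on_max with
  | empty =>
    intro _ _
    obtain ⟨R, hR⟩ := LinearResolution.exists_bot (σ := Fin (m + 2)) (𝕜 := 𝕜) (m * (s + t))
    have e : Ideal.span (genMonomial 𝕜 '' {b : Fin (m + 2) → ℕ |
        toLex b ∈ (∅ : Finset (Lex (Fin (m + 2) → ℕ)))}) = ⊥ := by simp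
    rw [e]
    exact ⟨R, by simpa using hR⟩
  | insert a S hlt ih =>
    intro hmem hlow
    obtain ⟨F, hF⟩ := ih (fun b hb => hmem b (Finset.mem_insert_of_mem hb)) fun b hb c hc hcb =>
      (Finset.mem_insert.1 (hlow b (Finset.mem_insert_of_mem hb) c hc hcb)).resolve_left
        (hcb.trans (hlt b hb)).ne
    have ha := hmem a (Finset.mem_insert_self _ _)
    have haS : a ∉ S := fun h => lt_irrefl _ (hlt a h)
    have e1 : {b | toLex b ∈ S} = {b | b ∈ genVectors m s t ∧ toLex b < toLex (ofLex a)} := by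
      ext b
      refine ⟨fun hb => ⟨hmem _ (Finset.mem_insert_of_mem hb), hlt _ hb⟩, fun hb => ?_⟩
      exact (Finset.mem_insert.1 (hlow a (Finset.mem_insert_self _ _) b hb.1 hb.2)).resolve_left
        hb.2.ne
    have e2 : Ideal.span (genMonomial 𝕜 '' {b | toLex b ∈ insert a S}) =
        Ideal.span (genMonomial 𝕜 '' {b | toLex b ∈ S}) ⊔
          Ideal.span {genMonomial 𝕜 (ofLex a)} := by
      rw [sup_comm, ← Ideal.span_insert, ← Set.image_insert_eq]
      congr 2
      ext b
      simp only [Finset.mem_insert]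
      rfl
    rw [e2]
    by_cases hred : IsRedundant (ofLex a)
    · have h := hred.genMonomial_mem 𝕜 ha
      rw [← e1] at h
      rw [sup_eq_left.2 ((Ideal.span_singleton_le_iff_mem _).2 h)]
      refine ⟨F, fun i => ?_⟩
      rw [hF, Finset.filter_insert, if_neg (not_not.2 hred)]
    · obtain ⟨R, hR⟩ := F.exists_linear_quotient (colonVars (ofLex a))
        (by
          have := isHomogeneous_genMonomial 𝕜 (ofLex a)
          rwa [(mem_genVectors.1 ha).1] at this)
        (by
          rw [e1]
          exact mul_mem_span_iff 𝕜 ha hred)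
      refine ⟨R, fun i => ?_⟩
      rw [hR, hF, Finset.filter_insert, if_pos hred, Finset.sum_insert (by simp [haS]), add_comm]

end Monomials

end PathIdealPowers

/-! ### Generating functions -/

namespace PathIdealPowers

section GeneratingFunctions

open Finset

/-- The generating series of a weight `F` on `k`-tuples of natural numbers, by their sum. -/
noncomputable def tupleSeries {R : Type*} [CommRing R] (k : ℕ) (F : (Fin k → ℕ) → R) :
    PowerSeries R :=
  PowerSeries.mk fun s => ∑ x ∈ Nat.antidiagonalTuple k s, F x

lemma sum_antidiagonalTuple_succ {M : Type*} [AddCommMonoid M] (k s : ℕ)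
    (F : (Fin (k + 1) → ℕ) → M) :
    ∑ x ∈ Nat.antidiagonalTuple (k + 1) s, F x =
      ∑ p ∈ antidiagonal s, ∑ x ∈ Nat.antidiagonalTuple k p.2, F (Fin.cons p.1 x) := by
  rw [sum_sigma']
  refine sum_bij' (fun x _ => ⟨(x 0, s - x 0), Fin.tail x⟩) (fun y _ => Fin.cons y.1.1 y.2)
    ?_ ?_ ?_ ?_ ?_
  · intro x hx
    rw [Nat.mem_antidiagonalTuple, Fin.sum_univ_succ] at hx
    simp only [mem_sigma, HasAntidiagonal.mem_antidiagonal, Nat.mem_antidiagonalTuple, Fin.tail]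
    omega
  · rintro ⟨⟨p, q⟩, x⟩ hx
    simp only [mem_sigma, HasAntidiagonal.mem_antidiagonal, Nat.mem_antidiagonalTuple] at hx
    rw [Nat.mem_antidiagonalTuple, Fin.sum_univ_succ]
    simp only [Fin.cons_zero, Fin.cons_succ]
    omega
  · intro x _
    exact Fin.cons_self_tail x
  · rintro ⟨⟨p, q⟩, x⟩ hx
    simp only [mem_sigma, HasAntidiagonal.mem_antidiagonal, Nat.mem_antidiagonalTuple] at hx
    simp only [Fin.cons_zero, Fin.tail_cons, Sigma.mk.injEq, Prod.mk.injEq, heq_eq_eq, and_true,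
      true_and]
    omega
  · intro x _
    simp

lemma tupleSeries_succ {R : Type*} [CommRing R] {k : ℕ} {F : (Fin (k + 1) → ℕ) → R} {f : ℕ → R}
    {G : (Fin k → ℕ) → R} (h : ∀ p x, F (Fin.cons p x) = f p * G x) :
    tupleSeries (k + 1) F = PowerSeries.mk f * tupleSeries k G := by
  ext s
  rw [PowerSeries.coeff_mul, tupleSeries, PowerSeries.coeff_mk, sum_antidiagonalTuple_succ]
  refine sum_congr rfl fun p _ => ?_
  simp only [h, tupleSeries, PowerSeries.coeff_mk, mul_sum]

lemma tupleSeries_add {R : Type*} [CommRing R] {k : ℕ} (F G : (Fin k → ℕ) → R) :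
    tupleSeries k (fun x => F x + G x) = tupleSeries k F + tupleSeries k G := by
  ext s
  simp [tupleSeries, sum_add_distrib]

lemma tupleSeries_zero {R : Type*} [CommRing R] (F : (Fin 0 → ℕ) → R) :
    tupleSeries 0 F = PowerSeries.C (F ![]) := by
  ext s
  cases s <;> simp [tupleSeries, PowerSeries.coeff_C]

/-- A tuple, extended by zero to a function on the natural numbers. -/
def extendZero {k : ℕ} (x : Fin k → ℕ) (j : ℕ) : ℕ := if h : j < k then x ⟨j, h⟩ else 0

lemma extendZero_cons_zero {k : ℕ} (p : ℕ) (x : Fin k → ℕ) :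
    extendZero (Fin.cons p x : Fin (k + 1) → ℕ) 0 = p := rfl

lemma extendZero_cons_succ {k : ℕ} (p : ℕ) (x : Fin k → ℕ) (j : ℕ) :
    extendZero (Fin.cons p x : Fin (k + 1) → ℕ) (j + 1) = extendZero x j := by
  unfold extendZero
  by_cases h : j < k
  · rw [dif_pos h, dif_pos (Nat.succ_lt_succ h)]; rfl
  · rw [dif_neg h, dif_neg (by omega)]

/-- The number of positive values of `x` on `{0, …, m - 1}`. -/
def posCount (m : ℕ) (x : ℕ → ℕ) : ℕ := #{u ∈ range m | 0 < x u}

open Classical in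
/-- The number of variables in the colon ideal of an exponent vector with positive `0`-th entry
and remaining entries `x`. -/
noncomputable def chainCount (m : ℕ) (x : ℕ → ℕ) : ℕ :=
  #{u ∈ range m | 0 < x u ∨ IsChain x u} + 1

lemma card_filter_range_succ_zero (m : ℕ) (P : ℕ → Prop) [DecidablePred P] :
    #{u ∈ range (m + 1) | P u} = #{u ∈ range m | P (u + 1)} + if P 0 then 1 else 0 := by
  simp only [card_filter, sum_range_succ']

lemma posCount_succ (m : ℕ) (x : ℕ → ℕ) :
    posCount (m + 1) x = posCount m (fun j => x (j + 1)) + if 0 < x 0 then 1 else 0 :=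
  card_filter_range_succ_zero m _

lemma isChain_one (x : ℕ → ℕ) : ¬ IsChain x 1 := fun h => by simpa using h.1

lemma isChain_add_two_iff_shift {x : ℕ → ℕ} {u : ℕ} :
    IsChain x (u + 2) ↔ 0 < x 1 ∧ IsChain (fun j => x (j + 2)) u := by
  constructor
  · rintro ⟨h1, h2⟩
    exact ⟨h2 1 (by omega) odd_one, by simpa [Nat.even_add] using h1, fun j hj ho =>
      h2 (j + 2) (by omega) (ho.add_even even_two)⟩
  · rintro ⟨h0, h1, h2⟩
    refine ⟨h1.add even_two, fun j hj ho => ?_⟩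
    rcases j with _ | _ | j
    · simp at ho
    · exact h0
    · exact h2 j (by omega) (by simpa [Nat.odd_add_one, Nat.even_add_one] using ho)

lemma chainCount_one (x : ℕ → ℕ) : chainCount 1 x = 2 := by
  classical
  rw [chainCount, card_filter_range_succ_zero]
  simp [isChain_zero]

lemma chainCount_add_two_of_eq_zero {m : ℕ} {x : ℕ → ℕ} (h : x 1 = 0) :
    chainCount (m + 2) x = 2 + posCount m fun j => x (j + 2) := by
  classical
  unfold chainCount posCount
  rw [card_filter_range_succ_zero, card_filter_range_succ_zero]
  simp [isChain_zero, isChain_one, isChain_add_two_iff_shift, h]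
  ring

lemma chainCount_add_two_of_pos {m : ℕ} {x : ℕ → ℕ} (h : 0 < x 1) :
    chainCount (m + 2) x = 2 + chainCount m fun j => x (j + 2) := by
  classical
  unfold chainCount
  rw [card_filter_range_succ_zero, card_filter_range_succ_zero]
  simp [isChain_zero, isChain_add_two_iff_shift, h]
  ring

open Polynomial in
/-- The generating series of the Betti numbers of the powers of `J_n`, where `n = m + 2`. -/
noncomputable def omittedSeries (m : ℕ) : PowerSeries ℤ[X] :=
  tupleSeries (m + 1) fun x => (1 + X) ^ posCount m (extendZero x)

open Polynomial Classical in
/-- The generating series of the contributions to the Betti numbers of `J_n ^ s * I_n ^ t` of the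
generators with maximal exponent `t > 0` at the generator of `I_n` missing from `J_n`,
where `n = m + 2`. -/
noncomputable def chainSeries (m : ℕ) : PowerSeries ℤ[X] :=
  tupleSeries (m + 1) fun x =>
    if IsChain (extendZero x) m then 0 else (1 + X) ^ chainCount m (extendZero x)

/-- The variable that records the homological degree. -/
noncomputable abbrev yVar : PowerSeries (Polynomial ℤ) := PowerSeries.C Polynomial.X

/-- The variable that records the exponent `s`. -/
noncomputable abbrev zVar : PowerSeries (Polynomial ℤ) := PowerSeries.X

/-- The geometric series in `zVar`. -/
noncomputable abbrev geom : PowerSeries (Polynomial ℤ) := PowerSeries.mk 1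

lemma geom_mul : geom * (1 - zVar) = 1 := PowerSeries.mk_one_mul_one_sub_eq_one _

lemma mk_ite_eq_zero {R : Type*} [CommRing R] (a b : R) :
    PowerSeries.mk (fun p => if 0 < p then a else b) =
      PowerSeries.C b + PowerSeries.C a * (PowerSeries.X * PowerSeries.mk 1) := by
  ext p
  rcases p with _ | p
  · simp
  · simp [PowerSeries.coeff_succ_X_mul]

lemma omittedSeries_zero : omittedSeries 0 = geom := by
  unfold omittedSeries
  rw [tupleSeries_succ (f := 1) (G := fun _ => 1), tupleSeries_zero]
  · simp
  · intro p x; simp [posCount]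

lemma omittedSeries_succ (m : ℕ) :
    omittedSeries (m + 1) = (1 + (1 + yVar) * (zVar * geom)) * omittedSeries m := by
  unfold omittedSeries
  rw [tupleSeries_succ (f := fun p => if 0 < p then 1 + Polynomial.X else 1)
    (G := fun x => (1 + Polynomial.X) ^ posCount m (extendZero x)), mk_ite_eq_zero]
  · simp
  · intro p x
    rw [posCount_succ, extendZero_cons_zero, pow_add, mul_comm]
    simp only [extendZero_cons_succ]
    split_ifs <;> simp

lemma omittedSeries_eq (m : ℕ) : omittedSeries m = (1 + yVar * zVar) ^ m * geom ^ (m + 1) := by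
  induction m with
  | zero => simp [omittedSeries_zero]
  | succ m ih =>
    rw [omittedSeries_succ, ih]
    have h := geom_mul
    linear_combination (-(1 + yVar * zVar) ^ m * geom ^ (m + 1)) * h

lemma chainSeries_zero : chainSeries 0 = 0 := by
  ext s
  simp [chainSeries, tupleSeries, isChain_zero]

lemma chainSeries_one : chainSeries 1 = (1 + yVar) ^ 2 * geom ^ 2 := by
  unfold chainSeries
  rw [tupleSeries_succ (f := 1) (G := fun _ => (1 + Polynomial.X) ^ 2),
    tupleSeries_succ (f := fun _ => (1 + Polynomial.X) ^ 2) (G := fun _ => 1), tupleSeries_zero]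
  · have : PowerSeries.mk (fun _ => (1 + Polynomial.X : Polynomial ℤ) ^ 2) =
        (1 + yVar) ^ 2 * geom := by
      ext1 s
      rw [← map_one PowerSeries.C, ← map_add, ← map_pow, PowerSeries.coeff_C_mul]
      simp
    rw [this]
    simp only [map_one, mul_one]
    change geom * _ = _
    ring
  · intro p x; simp
  · intro p x; simp [isChain_one, chainCount_one]

/-- The recursion from splitting off the first two entries: the second one decides whether the
chain goes on. -/
lemma chainSeries_add_two (m : ℕ) : chainSeries (m + 2) =
    (1 + yVar) ^ 2 * (geom * omittedSeries m + zVar * geom ^ 2 * chainSeries m) := by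
  classical
  let w : (Fin (m + 1) → ℕ) → Polynomial ℤ := fun x =>
    if IsChain (extendZero x) m then 0 else (1 + Polynomial.X) ^ chainCount m (extendZero x)
  let u : (Fin (m + 1) → ℕ) → Polynomial ℤ := fun x =>
    (1 + Polynomial.X) ^ posCount m (extendZero x)
  let c : Polynomial ℤ := (1 + Polynomial.X) ^ 2
  -- the cases where the chain stops at once and where it goes on
  let F₀ : (Fin (m + 2) → ℕ) → Polynomial ℤ := fun x =>
    (if 0 < x 0 then 0 else c) * u (Fin.tail x)
  let F₁ : (Fin (m + 2) → ℕ) → Polynomial ℤ := fun x =>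
    (if 0 < x 0 then c else 0) * w (Fin.tail x)
  have e : chainSeries (m + 2) = PowerSeries.mk 1 * tupleSeries (m + 2) (fun x => F₀ x + F₁ x) := by
    refine tupleSeries_succ fun p x => ?_
    obtain ⟨q, x, rfl⟩ : ∃ q x', x = Fin.cons q x' := ⟨_, _, (Fin.cons_self_tail x).symm⟩
    have h1 : extendZero (Fin.cons p (Fin.cons q x : Fin (m + 2) → ℕ) : Fin (m + 3) → ℕ) 1 = q := by
      rw [extendZero_cons_succ, extendZero_cons_zero]
    simp only [F₀, F₁, u, w, Fin.cons_zero, Fin.tail_cons, Pi.one_apply, one_mul]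
    rcases Nat.eq_zero_or_pos q with rfl | hq
    · rw [chainCount_add_two_of_eq_zero h1, isChain_add_two_iff_shift]
      simp only [h1, extendZero_cons_succ, lt_irrefl, false_and, if_false, zero_mul, add_zero,
        pow_add]
      rfl
    · rw [chainCount_add_two_of_pos (h1.symm ▸ hq), isChain_add_two_iff_shift]
      simp only [h1, extendZero_cons_succ, hq, true_and, if_true, zero_mul, zero_add, pow_add]
      split_ifs <;> simp [c]
  rw [e, tupleSeries_add, tupleSeries_succ (F := F₀) (f := fun q => if 0 < q then 0 else c) (G := u),
    tupleSeries_succ (F := F₁) (f := fun q => if 0 < q then c else 0) (G := w), mk_ite_eq_zero,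
    mk_ite_eq_zero]
  · have hu : tupleSeries (m + 1) u = omittedSeries m := rfl
    have hw : tupleSeries (m + 1) w = chainSeries m := rfl
    have hc : PowerSeries.C c = (1 + yVar) ^ 2 := by simp [c]
    rw [hu, hw, hc]
    simp only [map_zero]
    ring
  · intro q x; rfl
  · intro q x; rfl

/-- The closed form of a combination of the two series: once the Betti numbers are known to be
`p⁺ - p⁻ + pᶜ`, its coefficients are the differences of `p⁺ - p⁻` at `(s, t + 1)` and `(s + 1, t)`. The factor `1 - y ^ 2 * z` on the left is the source
of the summation over `j` in `p⁺` and `p⁻`. -/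
lemma chainSeries_eq (m : ℕ) :
    (1 - yVar ^ 2 * zVar) * (zVar * chainSeries m + (1 - zVar) * omittedSeries m) =
      ((1 + yVar * zVar) ^ (m + 2) -
        yVar ^ (m % 2) * zVar ^ (m / 2 + 1 + m % 2) * (1 + yVar) ^ (m + 2)) *
        geom ^ (m + 1) := by
  have hG := geom_mul
  induction m using Nat.twoStepInduction with
  | zero =>
    rw [chainSeries_zero, omittedSeries_zero]
    simp only [Nat.zero_mod, Nat.zero_div, pow_zero]
    ring
  | one =>
    rw [chainSeries_one, omittedSeries_eq]
    simp only [Nat.one_mod, Nat.reduceDiv]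
    ring
  | more m ih _ =>
    rw [omittedSeries_eq] at ih
    rw [chainSeries_add_two, omittedSeries_eq, omittedSeries_eq,
      show (m + 2) % 2 = m % 2 by omega,
      show (m + 2) / 2 + 1 + m % 2 = m / 2 + 1 + m % 2 + 1 by omega]
    linear_combination (1 + yVar) ^ 2 * zVar * geom ^ 2 * ih -
      (1 - yVar ^ 2 * zVar) * zVar * (1 + yVar) ^ 2 * (1 + yVar * zVar) ^ m * geom ^ (m + 2) * hG

end GeneratingFunctions

end PathIdealPowers

/-! ### Coefficients of the generating functions -/

namespace PathIdealPowers

section Coefficients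

open Finset

lemma coeff_one_add_yVar_mul_zVar_pow (N a : ℕ) :
    PowerSeries.coeff a ((1 + yVar * zVar) ^ N) =
      Polynomial.X ^ a * (N.choose a : Polynomial ℤ) := by
  have h : (1 + yVar * zVar) ^ N = PowerSeries.rescale Polynomial.X
      ((((1 + Polynomial.X) ^ N : Polynomial (Polynomial ℤ))) : PowerSeries (Polynomial ℤ)) := by
    simp [PowerSeries.rescale_X]
  rw [h, PowerSeries.coeff_rescale, Polynomial.coeff_coe, Polynomial.coeff_one_add_X_pow]

lemma coeff_geom_pow (m s : ℕ) :
    PowerSeries.coeff s (geom ^ (m + 1)) = ((m + s).choose m : Polynomial ℤ) := by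
  rw [geom, PowerSeries.mk_one_pow_eq_mk_choose_add, PowerSeries.coeff_mk]

lemma binom_natCast (a c : ℕ) : binom a c = a.choose c := by
  unfold binom
  split_ifs with h
  · simp
  · rw [Nat.choose_eq_zero_of_lt (by omega)]; rfl

lemma binom_of_lt {a c : ℤ} (h : a < c) : binom a c = 0 := if_neg (by omega)

lemma binom_of_neg {a c : ℤ} (h : c < 0) : binom a c = 0 := if_neg (by omega)

lemma binom_succ_sub (a : ℤ) (c : ℕ) :
    binom (a + 1) (c + 1) - binom a (c + 1) = binom a c := by
  rcases lt_or_ge a 0 with h | h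
  · rw [binom_of_lt (by omega), binom_of_lt (by omega), binom_of_lt (by omega), sub_zero]
  · lift a to ℕ using h
    have := Nat.choose_succ_succ a c
    exact_mod_cast (by rw [binom_natCast, binom_natCast, this]; push_cast; ring :
      binom ((a + 1 : ℕ) : ℤ) ((c + 1 : ℕ) : ℤ) - binom a ((c + 1 : ℕ) : ℤ) = a.choose c).trans
        (binom_natCast a c).symm

lemma coeff_pow_mul_geom_pow (N m σ i : ℕ) :
    (PowerSeries.coeff σ ((1 + yVar * zVar) ^ N * geom ^ (m + 1))).coeff i =
      binom N i * binom (m + σ - i) m := by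
  rw [PowerSeries.coeff_mul, Polynomial.finsetSum_coeff]
  have h (p : ℕ × ℕ) : (PowerSeries.coeff p.1 ((1 + yVar * zVar) ^ N) *
      PowerSeries.coeff p.2 (geom ^ (m + 1))).coeff i =
        if i = p.1 then (N.choose p.1 * (m + p.2).choose m : ℤ) else 0 := by
    rw [coeff_one_add_yVar_mul_zVar_pow, coeff_geom_pow, mul_assoc, ← Nat.cast_mul, mul_comm,
      ← Polynomial.C_eq_natCast, Polynomial.coeff_C_mul_X_pow]
    simp
  simp only [h]
  by_cases hi : i ≤ σ
  · rw [sum_eq_single (i, σ - i)]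
    · rw [if_pos rfl, ← Nat.cast_add, ← Nat.cast_sub (by omega), binom_natCast, binom_natCast,
        Nat.add_sub_assoc hi]
    · rintro ⟨a, b⟩ hab hne
      rw [HasAntidiagonal.mem_antidiagonal] at hab
      refine if_neg fun h => hne ?_
      simp only at h hab ⊢
      rw [Prod.mk.injEq]; omega
    · intro h; exact absurd (HasAntidiagonal.mem_antidiagonal.2 (by simp only; omega)) h
  · rw [binom_of_lt (c := m) (by omega), mul_zero]
    refine sum_eq_zero fun p hp => if_neg ?_
    rw [HasAntidiagonal.mem_antidiagonal] at hp
    omega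

lemma coeff_monomial_mul_geom_pow (N m ε r σ i : ℕ) :
    (PowerSeries.coeff σ (yVar ^ ε * zVar ^ r * (1 + yVar) ^ N * geom ^ (m + 1))).coeff i =
      binom N (i - ε) * binom (m + σ - r) m := by
  have h : yVar ^ ε * zVar ^ r * (1 + yVar) ^ N * geom ^ (m + 1) =
      PowerSeries.C ((1 + Polynomial.X) ^ N * Polynomial.X ^ ε) * (zVar ^ r * geom ^ (m + 1)) := by
    simp only [map_mul, map_pow, map_add, map_one]
    ring
  rw [h, PowerSeries.coeff_C_mul, PowerSeries.coeff_X_pow_mul']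
  split_ifs with hr
  · rw [coeff_geom_pow, ← Polynomial.C_eq_natCast, Polynomial.coeff_mul_C,
      Polynomial.coeff_mul_X_pow', ← Nat.cast_add,
      ← Nat.cast_sub (hr.trans (Nat.le_add_left σ m)), binom_natCast, Nat.add_sub_assoc hr]
    split_ifs with hε
    · rw [Polynomial.coeff_one_add_X_pow, ← Nat.cast_sub hε, binom_natCast]
    · rw [binom_of_neg (by omega), zero_mul]
  · rw [binom_of_lt (c := m) (by omega)]
    simp

/-- Division by `1 - y ^ 2 * z` on the level of coefficients. -/
lemma eq_sum_of_recursion {Y : ℕ → ℕ → ℤ} {e : ℤ → ℤ → ℤ} (he : ∀ σ i, σ < 0 → e σ i = 0)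
    (h0 : ∀ i : ℕ, Y 0 i = e 0 i) (h1 : ∀ σ : ℕ, Y σ 0 = e σ 0) (h2 : ∀ σ : ℕ, Y σ 1 = e σ 1)
    (h3 : ∀ σ i : ℕ, Y (σ + 1) (i + 2) = Y σ i + e (σ + 1) (i + 2)) (σ i : ℕ) :
    Y σ i = ∑ j ∈ Icc (0 : ℤ) (i / 2), e (σ - j) (i - 2 * j) := by
  induction i using Nat.twoStepInduction generalizing σ with
  | zero => simp [h1]
  | one => simp [h2]
  | more i ih _ =>
    have hI : Icc (0 : ℤ) (((i + 2 : ℕ) : ℤ) / 2) =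
        insert 0 ((Icc (0 : ℤ) (i / 2)).map (addRightEmbedding 1)) := by
      rw [map_add_right_Icc]
      ext j
      simp only [mem_insert, mem_Icc]
      push_cast
      omega
    rw [hI, sum_insert (by simp), sum_map]
    cases σ with
    | zero =>
      rw [sum_eq_zero fun j hj => he _ _ ?_]
      · simp [h0]
      · have := (mem_Icc.1 hj).1
        simp only [addRightEmbedding_apply]
        push_cast
        omega
    | succ σ =>
      rw [h3, ih, add_comm]
      congr 1
      refine sum_congr rfl fun j _ => ?_
      simp only [addRightEmbedding_apply]
      congr 1
      · push_cast; ring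
      · push_cast; ring

/-- The contribution of `j = 0` to the difference of `p⁺ - p⁻` at `(n, σ - 1, t + 1)` and at
`(n, σ, t)`, where `n = m + 2`. -/
def stepTerm (m : ℕ) (σ i : ℤ) : ℤ :=
  binom (m + 2 : ℕ) i * binom (m + σ - i) m -
    binom (m + 2 : ℕ) (i - (m % 2 : ℕ)) * binom (m + σ - (m / 2 + 1 + m % 2 : ℕ)) m

lemma stepTerm_of_neg {m : ℕ} {σ : ℤ} (i : ℤ) (h : σ < 0) : stepTerm m σ i = 0 := by
  unfold stepTerm
  rw [binom_of_lt (a := m + σ - (m / 2 + 1 + m % 2 : ℕ)) (by omega), mul_zero, sub_zero]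
  rcases lt_or_ge i 0 with hi | hi
  · rw [binom_of_neg hi, zero_mul]
  · rw [binom_of_lt (a := m + σ - i) (by omega), mul_zero]

/-- The coefficients of `chainSeries_eq`, divided by `1 - y ^ 2 * z`. -/
lemma coeff_chainSeries (m s i : ℕ) :
    (PowerSeries.coeff s (chainSeries m)).coeff i +
      (PowerSeries.coeff (s + 1) (omittedSeries m)).coeff i -
        (PowerSeries.coeff s (omittedSeries m)).coeff i =
      ∑ j ∈ Icc (0 : ℤ) (i / 2), stepTerm m (s + 1 - j) (i - 2 * j) := by
  set Y := zVar * chainSeries m + (1 - zVar) * omittedSeries m with hY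
  have hstep (σ i : ℕ) : (PowerSeries.coeff σ (((1 + yVar * zVar) ^ (m + 2) -
      yVar ^ (m % 2) * zVar ^ (m / 2 + 1 + m % 2) * (1 + yVar) ^ (m + 2)) *
        geom ^ (m + 1))).coeff i = stepTerm m σ i := by
    rw [sub_mul, map_sub, Polynomial.coeff_sub, coeff_pow_mul_geom_pow, coeff_monomial_mul_geom_pow]
    rfl
  rw [← chainSeries_eq, ← hY] at hstep
  have hexp : (1 - yVar ^ 2 * zVar) * Y = Y - PowerSeries.C (Polynomial.X ^ 2) * (zVar * Y) := by
    rw [map_pow]; ring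
  rw [hexp] at hstep
  have h0 (i : ℕ) : (PowerSeries.coeff 0 Y).coeff i = stepTerm m (0 : ℕ) i := by
    rw [← hstep, map_sub, PowerSeries.coeff_C_mul, PowerSeries.coeff_zero_X_mul, mul_zero, sub_zero]
  have hs (σ i : ℕ) : (PowerSeries.coeff (σ + 1) Y).coeff i -
      (Polynomial.X ^ 2 * PowerSeries.coeff σ Y).coeff i = stepTerm m ((σ + 1 : ℕ) : ℤ) i := by
    rw [← hstep, map_sub, PowerSeries.coeff_C_mul, PowerSeries.coeff_succ_X_mul,
      Polynomial.coeff_sub]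
  have key := eq_sum_of_recursion (Y := fun σ i => (PowerSeries.coeff σ Y).coeff i)
    (e := stepTerm m) (fun σ i h => stepTerm_of_neg i h) (by simpa using h0)
    (fun σ => by
      cases σ with
      | zero => exact h0 0
      | succ σ => simpa [mul_comm, Polynomial.coeff_mul_X_pow'] using hs σ 0)
    (fun σ => by
      cases σ with
      | zero => exact h0 1
      | succ σ =>
        have := hs σ 1
        rw [mul_comm, Polynomial.coeff_mul_X_pow', if_neg (by norm_num), sub_zero] at this
        exact this)
    (fun σ i => by
      have := hs σ (i + 2)
      rw [mul_comm, Polynomial.coeff_mul_X_pow] at this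
      push_cast at this
      linarith) (s + 1) i
  have e : PowerSeries.coeff (s + 1) Y = PowerSeries.coeff s (chainSeries m) +
      PowerSeries.coeff (s + 1) (omittedSeries m) - PowerSeries.coeff s (omittedSeries m) := by
    rw [hY, sub_mul, one_mul, map_add, map_sub, PowerSeries.coeff_succ_X_mul,
      PowerSeries.coeff_succ_X_mul]
    ring
  simp only [e, Polynomial.coeff_add, Polynomial.coeff_sub] at key
  rw [key]
  push_cast
  rfl

lemma coeff_omittedSeries (m s i : ℕ) :
    (PowerSeries.coeff s (omittedSeries m)).coeff i = pConst (m + 2 : ℕ) s i := by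
  rw [omittedSeries_eq, coeff_pow_mul_geom_pow, pConst]
  congr 2 <;> push_cast <;> ring

lemma pNeg_eq (m : ℕ) (s t i : ℤ) : pNeg (m + 2 : ℕ) s t i =
    ∑ j ∈ Icc 0 (i / 2), binom (m + 2 : ℕ) (i - (m % 2 : ℕ) - 2 * j) *
      (binom (s + t + (m / 2 : ℕ) - j) (m + 1) - binom (s + (m / 2 : ℕ) - j) (m + 1)) := by
  have e1 : (((m + 2 : ℕ) : ℤ) - 1) = m + 1 := by push_cast; ring
  have e2 (a j : ℤ) : a + ((m + 2 : ℕ) : ℤ) / 2 - 1 - j = a + (m / 2 : ℕ) - j := by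
    push_cast; omega
  unfold pNeg
  simp only [e1, e2]
  split_ifs with h
  · have hm : m % 2 = 1 := by
      rw [Int.odd_iff] at h; omega
    rw [hm]
    refine sum_subset (fun j hj => ?_) fun j hj hj' => ?_
    · rw [mem_Icc] at hj ⊢; omega
    · rw [mem_Icc] at hj hj'
      rw [binom_of_neg (by omega), zero_mul]
  · have hm : m % 2 = 0 := by
      rw [Int.not_odd_iff_even, Int.even_iff] at h; omega
    rw [hm]
    simp

lemma p_succ_sub (m : ℕ) (s t i : ℤ) :
    p (m + 2 : ℕ) s (t + 1) i - p (m + 2 : ℕ) (s + 1) t i =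
      ∑ j ∈ Icc 0 (i / 2), stepTerm m (s + 1 - j) (i - 2 * j) +
        pConst (m + 2 : ℕ) s i - pConst (m + 2 : ℕ) (s + 1) i := by
  have hsum : (pPos (m + 2 : ℕ) s (t + 1) i - pPos (m + 2 : ℕ) (s + 1) t i) -
      (pNeg (m + 2 : ℕ) s (t + 1) i - pNeg (m + 2 : ℕ) (s + 1) t i) =
        ∑ j ∈ Icc 0 (i / 2), stepTerm m (s + 1 - j) (i - 2 * j) := by
    rw [pNeg_eq, pNeg_eq, pPos, pPos, ← sum_sub_distrib, ← sum_sub_distrib, ← sum_sub_distrib]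
    refine sum_congr rfl fun j _ => ?_
    have h1 := binom_succ_sub (m + (s + 1 - j) - (i - 2 * j)) m
    have h2 := binom_succ_sub (m + (s + 1 - j) - (m / 2 + 1 + m % 2 : ℕ)) m
    rw [stepTerm, ← h1, ← h2]
    have e1 : (((m + 2 : ℕ) : ℤ) - 1) = m + 1 := by push_cast; ring
    have e2 : ((m + 2 : ℕ) : ℤ) + s + (t + 1) - 1 - i + j =
      ((m + 2 : ℕ) : ℤ) + (s + 1) + t - 1 - i + j := by ring
    have e3 : ((m + 2 : ℕ) : ℤ) + (s + 1) - 1 - i + j =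
      m + (s + 1 - j) - (i - 2 * j) + 1 := by push_cast; ring
    have e4 : ((m + 2 : ℕ) : ℤ) + s - 1 - i + j = m + (s + 1 - j) - (i - 2 * j) := by
      push_cast; ring
    have e5 : s + (t + 1) + (m / 2 : ℕ) - j = s + 1 + t + (m / 2 : ℕ) - j := by ring
    have e6 : s + 1 + (m / 2 : ℕ) - j = m + (s + 1 - j) - (m / 2 + 1 + m % 2 : ℕ) + 1 := by
      push_cast; omega
    have e7 : s + (m / 2 : ℕ) - j = m + (s + 1 - j) - (m / 2 + 1 + m % 2 : ℕ) := by
      push_cast; omega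
    have e8 : i - (m % 2 : ℕ) - 2 * j = i - 2 * j - (m % 2 : ℕ) := by ring
    rw [e1, e2, e3, e4, e5, e6, e7, e8]
    ring
  rw [p, p, ← hsum]
  ring

lemma p_zero_right (n s i : ℤ) : p n s 0 i = pConst n s i := by
  simp [p, pPos, pNeg]

lemma p_of_neg (n s t : ℤ) {i : ℤ} (h : i < 0) : p n s t i = 0 := by
  have h1 : Icc (0 : ℤ) (i / 2) = ∅ := Icc_eq_empty (by omega)
  have h2 : Icc (0 : ℤ) ((i - 1) / 2) = ∅ := Icc_eq_empty (by omega)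
  simp [p, pPos, pNeg, pConst, h1, h2, binom_of_neg h]

end Coefficients

/-! ### Counting generators by the size of their colon ideals -/

section Count

open Finset
open scoped Fin.CommRing

variable {m : ℕ}

lemma cons_natCast_succ (c : ℕ) (x : Fin (m + 1) → ℕ) {u : ℕ} (hu : u < m + 1) :
    (Fin.cons c x : Fin (m + 2) → ℕ) ((u + 1 : ℕ) : Fin (m + 2)) = extendZero x u := by
  have : ((u + 1 : ℕ) : Fin (m + 2)) = Fin.succ ⟨u, hu⟩ :=
    Fin.ext (Fin.val_cast_of_lt (by omega))
  rw [this, Fin.cons_succ, extendZero, dif_pos hu]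

lemma isChain_congr {x x' : ℕ → ℕ} {u : ℕ} (h : ∀ j < u, x j = x' j) :
    IsChain x u ↔ IsChain x' u :=
  and_congr_right fun _ => forall₂_congr fun j hj => by rw [h j hj]

lemma isChain_cons_iff (c : ℕ) (x : Fin (m + 1) → ℕ) {u : ℕ} (hu : u ≤ m) :
    IsChain (fun j => (Fin.cons c x : Fin (m + 2) → ℕ) ((j + 1 : ℕ) : Fin (m + 2))) u ↔
      IsChain (extendZero x) u :=
  isChain_congr fun j hj => cons_natCast_succ c x (by omega)

lemma isRedundant_cons_iff (c : ℕ) (x : Fin (m + 1) → ℕ) :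
    IsRedundant (Fin.cons c x : Fin (m + 2) → ℕ) ↔ 0 < c ∧ IsChain (extendZero x) m := by
  rw [IsRedundant, isChain_cons_iff c x le_rfl, Fin.cons_zero]

open Classical in
lemma card_colonVars_cons (c : ℕ) (x : Fin (m + 1) → ℕ) :
    #(colonVars (Fin.cons c x : Fin (m + 2) → ℕ)) =
      #{u ∈ range m | 0 < extendZero x u ∨ 0 < c ∧ IsChain (extendZero x) u} +
        if 0 < c then 1 else 0 := by
  rw [colonVars, card_filter]
  have h (u : Fin (m + 2)) : ((u.val < m ∧ (0 < (Fin.cons c x : Fin (m + 2) → ℕ) (u + 1) ∨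
      0 < (Fin.cons c x : Fin (m + 2) → ℕ) 0 ∧
        IsChain (fun j => (Fin.cons c x : Fin (m + 2) → ℕ) ((j + 1 : ℕ) : Fin (m + 2))) u)) ∨
      (u.val = m + 1 ∧ 0 < (Fin.cons c x : Fin (m + 2) → ℕ) 0)) ↔
      ((u.val < m ∧ (0 < extendZero x u.val ∨ 0 < c ∧ IsChain (extendZero x) u.val)) ∨
        (u.val = m + 1 ∧ 0 < c)) := by
    rw [Fin.cons_zero]
    refine or_congr_left (and_congr_right fun hu => ?_)
    rw [isChain_cons_iff c x hu.le, ← cons_natCast_succ c x (by omega), Nat.cast_succ,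
      Fin.cast_val_eq_self]
  simp only [h]
  rw [Fin.sum_univ_eq_sum_range (fun u => if (u < m ∧ (0 < extendZero x u ∨
    0 < c ∧ IsChain (extendZero x) u)) ∨ (u = m + 1 ∧ 0 < c) then 1 else 0), sum_range_succ,
    sum_range_succ, card_filter]
  simp only [lt_irrefl, false_and, false_or, true_and]
  congr 1
  · rw [if_neg (by omega), add_zero]
    refine sum_congr rfl fun u hu => ?_
    have := mem_range.1 hu
    simp [this, (this.trans (Nat.lt_succ_self m)).ne]
  · simp

lemma sum_filter_antidiagonalTuple {M : Type*} [AddCommMonoid M] (k s c : ℕ)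
    (F : (Fin (k + 1) → ℕ) → M) :
    ∑ a ∈ Nat.antidiagonalTuple (k + 1) (s + c) with a 0 = c, F a =
      ∑ x ∈ Nat.antidiagonalTuple k s, F (Fin.cons c x) := by
  refine sum_nbij' Fin.tail (fun x => Fin.cons c x) ?_ ?_ ?_ ?_ ?_
  · intro a ha
    simp only [mem_filter, Nat.mem_antidiagonalTuple, Fin.sum_univ_succ] at ha
    rw [Nat.mem_antidiagonalTuple]
    simp only [Fin.tail]
    omega
  · intro x hx
    rw [Nat.mem_antidiagonalTuple] at hx
    simp [Nat.mem_antidiagonalTuple, Fin.sum_univ_succ, hx, add_comm]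
  · rintro a ha
    rw [← (mem_filter.1 ha).2]
    exact Fin.cons_self_tail a
  · intro x _; exact Fin.tail_cons _ _
  · rintro a ha
    rw [← (mem_filter.1 ha).2, Fin.cons_self_tail]

open Classical in
/-- The polynomial whose `i`-th coefficient is the `i`-th Betti number of `J_n ^ s * I_n ^ t`, where
`n = m + 2`, see `exists_linearResolution`. -/
noncomputable def bettiPolynomial (m s t : ℕ) : Polynomial ℤ :=
  ∑ a ∈ genVectors m s t with ¬ IsRedundant a, (1 + Polynomial.X) ^ #(colonVars a)

lemma bettiPolynomial_zero (m s : ℕ) :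
    bettiPolynomial m s 0 = PowerSeries.coeff s (omittedSeries m) := by
  classical
  unfold bettiPolynomial omittedSeries tupleSeries
  rw [PowerSeries.coeff_mk, sum_filter]
  have e : genVectors m s 0 = {a ∈ Nat.antidiagonalTuple (m + 2) (s + 0) | a 0 = 0} := by
    simp [genVectors]
  rw [e, sum_filter_antidiagonalTuple]
  refine sum_congr rfl fun x _ => ?_
  rw [card_colonVars_cons, isRedundant_cons_iff]
  simp [posCount]

/-- The generators of `J_n ^ s * I_n ^ (t + 1)` are those of `J_n ^ (s + 1) * I_n ^ t` and those with
entry `t + 1` at `0`. Redundancy and colon ideals do not depend on `s` and `t`. -/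
lemma bettiPolynomial_succ (m s t : ℕ) : bettiPolynomial m s (t + 1) =
    bettiPolynomial m (s + 1) t + PowerSeries.coeff s (chainSeries m) := by
  classical
  unfold bettiPolynomial chainSeries tupleSeries
  rw [PowerSeries.coeff_mk, sum_filter,
    ← sum_filter_add_sum_filter_not (genVectors m s (t + 1)) (fun a => a 0 ≤ t)]
  congr 1
  · rw [← sum_filter, filter_comm]
    refine sum_congr ?_ fun _ _ => rfl
    ext a
    simp only [mem_filter, mem_genVectors]
    constructor
    · rintro ⟨⟨⟨h1, h2⟩, h3⟩, h4⟩
      exact ⟨⟨by omega, h4⟩, h3⟩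
    · rintro ⟨⟨h1, h2⟩, h3⟩
      exact ⟨⟨⟨by omega, by omega⟩, h3⟩, h2⟩
  · have e : {a ∈ genVectors m s (t + 1) | ¬ a 0 ≤ t} =
        {a ∈ Nat.antidiagonalTuple (m + 2) (s + (t + 1)) | a 0 = t + 1} := by
      ext a
      simp only [mem_filter, mem_genVectors, Nat.mem_antidiagonalTuple]
      omega
    rw [e, sum_filter_antidiagonalTuple]
    refine sum_congr rfl fun x _ => ?_
    rw [card_colonVars_cons, isRedundant_cons_iff]
    simp [chainCount]

lemma coeff_bettiPolynomial (m s t i : ℕ) :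
    (bettiPolynomial m s t).coeff i = p (m + 2 : ℕ) s t i := by
  induction t generalizing s with
  | zero => rw [bettiPolynomial_zero, coeff_omittedSeries, Nat.cast_zero, p_zero_right]
  | succ t ih =>
    have h1 := coeff_chainSeries m s i
    have h2 := p_succ_sub m s t i
    rw [coeff_omittedSeries, coeff_omittedSeries] at h1
    rw [bettiPolynomial_succ, Polynomial.coeff_add, ih]
    push_cast at h1 h2 ⊢
    linarith

end Count

end PathIdealPowers

theorem lemma5p1 (𝕜 : Type*) [Field 𝕜] (n s t : ℕ) (hn : 2 ≤ n) :
    (∀ i : ℕ, Module.Finite 𝕜 (PathIdealPowers.torSpace 𝕜 n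
      (PathIdealPowers.omittedIdeal 𝕜 n ^ s * PathIdealPowers.cycleIdeal 𝕜 n ^ t) i)) ∧
    ∀ i : ℤ, PathIdealPowers.b 𝕜 n s t i = PathIdealPowers.p n s t i := by
  classical
  obtain ⟨m, rfl⟩ := Nat.exists_eq_add_of_le' hn
  obtain ⟨R, hR⟩ := PathIdealPowers.exists_linearResolution 𝕜 m s t
  refine ⟨fun i => (R.finrank_torSpace i).1, fun i => ?_⟩
  unfold PathIdealPowers.b
  split_ifs with hi
  · lift i to ℕ using hi
    rw [← PathIdealPowers.coeff_bettiPolynomial, Int.toNat_natCast, (R.finrank_torSpace i).2, hR,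
      PathIdealPowers.bettiPolynomial, Polynomial.finsetSum_coeff]
    push_cast
    exact Finset.sum_congr rfl fun a _ => (Polynomial.coeff_one_add_X_pow ℤ _ i).symm
  · rw [PathIdealPowers.p_of_neg _ _ _ (not_le.1 hi)]
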